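/- Let $E/\mathbb{Q}$ be an elliptic curve and let $f=f_E=\sum_{n>0}a_nq^n\in S_2(\Gamma_0(N))$ be the newform attached to $E$: $f$ is a normalized newform of weight $2$ and level $\Gamma_0(N)$ whose Fourier coefficients $a_n$ are the coefficients of the Hasse–Weil $L$-function of $E$ (so $N$ is the conductor of $E$). Let $S_2(\Gamma_0(N),\mathbb{Z})$ be the group of cusp forms in $S_2(\Gamma_0(N))$ all of whose Fourier coefficients at $\infty$ are integers. Let $\mathbb{T}\subset\operatorname{End}_{\mathbb{C}}S_2(\Gamma_0(N))$ be the Hecke algebra, i.e. the subring generated by all Hecke operators $T_n$, $n\ge 1$, and put $I_f=\{T\in\mathbb{T} : Tf=0\}$. Write $S_2(\Gamma_0(N),\mathbb{Z})[I_f]$ for the subgroup of forms in $S_2(\Gamma_0(N),\mathbb{Z})$ annihilated by $I_f$, and $S_2(\Gamma_0(N),\mathbb{Z})[I_f]^{\perp}$ for the subgroup of forms in $S_2(\Gamma_0(N),\mathbb{Z})$ orthogonal to it for the Petersson inner product. Then there is a greatest integer $r_E\ge 1$ for which there exists $g=\sum_{n>0}b_nq^n\in S_2(\Gamma_0(N),\mathbb{Z})$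 that is orthogonal to $f$ for the Petersson inner product and satisfies $a_n\equiv b_n\pmod{r_E}$ for all $n$ (the congruence number of $E$). Moreover, the sum of $S_2(\Gamma_0(N),\mathbb{Z})[I_f]$ and $S_2(\Gamma_0(N),\mathbb{Z})[I_f]^{\perp}$ is direct, the quotient below is finite, and $$r_E=\#\left(\frac{S_2(\Gamma_0(N),\mathbb{Z})}{S_2(\Gamma_0(N),\mathbb{Z})[I_f]\oplus S_2(\Gamma_0(N),\mathbb{Z})[I_f]^{\perp}}\right).$$ -/

import Mathlib

noncomputable section
open UpperHalfPlane ModularForm CongruenceSubgroup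
open scoped MatrixGroups Manifold

namespace CongruenceNumber

/-- The space `S₂(Γ₀(N))` of cusp forms of weight two and level `Γ₀(N)`. -/
abbrev S2 (N : ℕ) : Type := CuspForm (Gamma0 N : Subgroup (GL (Fin 2) ℝ)) 2

/-- The formula
`(Tₙ f)(τ) = ∑_{ad = n, (a, N) = 1} ∑_{0 ≤ b < d} (n / d²) f((aτ + b) / d)`
for the `n`-th Hecke operator in weight two and level `Γ₀(N)`. -/
def heckeFun (N n : ℕ) (f : ℍ → ℂ) (τ : ℍ) : ℂ :=
  ∑ x ∈ n.divisorsAntidiagonal with x.1.Coprime N, ∑ b ∈ Finset.range x.2,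
    (n / (x.2 : ℂ) ^ 2) * f (ofComplex ((x.1 * τ + b) / x.2))

section HeckeWellDefined

lemma exists_decomp {N n : ℕ} (hn : 0 < n) {M : Matrix (Fin 2) (Fin 2) ℤ} (hdet : M.det = n)
    (hN : (N : ℤ) ∣ M 1 0) (hco : IsCoprime (M 0 0) (N : ℤ)) :
    ∃ γ ∈ Gamma0 N, ∃ a b d : ℕ, a * d = n ∧ a.Coprime N ∧ b < d ∧
      M = (γ : Matrix (Fin 2) (Fin 2) ℤ) * !![(a : ℤ), b; 0, d] := by
  obtain ⟨p, q, r, s, rfl⟩ : ∃ p q r s, M = !![p, q; r, s] :=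
    ⟨_, _, _, _, Matrix.eta_fin_two M⟩
  simp only [Matrix.det_fin_two_of, Matrix.of_apply, Matrix.cons_val', Matrix.cons_val_zero,
    Matrix.cons_val_one, Matrix.cons_val_fin_one] at hdet hN hco
  have hg : 0 < Int.gcd p r := by
    rw [Nat.pos_iff_ne_zero]
    intro h
    rw [Int.gcd_eq_zero_iff] at h
    simp [h.1, h.2] at hdet
    omega
  obtain ⟨p', hp⟩ := Int.gcd_dvd_left p r
  obtain ⟨r', hr⟩ := Int.gcd_dvd_right p r
  have hbez := Int.gcd_eq_gcd_ab p r
  generalize Int.gcdA p r = u at hbez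
  generalize Int.gcdB p r = v at hbez
  generalize hgg : Int.gcd p r = g at *
  have hgz : (g : ℤ) ≠ 0 := by exact_mod_cast hg.ne'
  have huv : p' * u + r' * v = 1 := by
    apply mul_left_cancel₀ hgz
    rw [hp, hr] at hbez
    linear_combination -hbez
  have hgd : (g : ℤ) * (p' * s - r' * q) = n := by
    rw [← hdet]; linear_combination -s * hp + q * hr
  have hd0 : 0 < p' * s - r' * q := by
    have : (0 : ℤ) < g * (p' * s - r' * q) := by rw [hgd]; exact_mod_cast hn
    exact pos_of_mul_pos_right this (by positivity)
  obtain ⟨d, hd⟩ := Int.eq_ofNat_of_zero_le hd0.le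
  have hdpos : (0 : ℤ) < d := by omega
  obtain ⟨b, hb⟩ := Int.eq_ofNat_of_zero_le (Int.emod_nonneg (u * q + v * s) hdpos.ne')
  have hbd := Int.emod_lt_of_pos (u * q + v * s) hdpos
  have hdm := Int.emod_add_mul_ediv (u * q + v * s) d
  generalize (u * q + v * s) / (d : ℤ) = k at hdm
  have hgco : IsCoprime (g : ℤ) N := hco.of_isCoprime_of_dvd_left ⟨p', hp⟩
  have hNr : (N : ℤ) ∣ r' := hgco.symm.dvd_of_dvd_mul_left (hr ▸ hN)
  refine ⟨⟨!![p', p' * k - v; r', r' * k + u], ?_⟩, ?_, g, b, d, ?_, ?_, ?_, ?_⟩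
  · rw [Matrix.det_fin_two_of]; linear_combination huv
  · change ((r' : ℤ) : ZMod N) = 0
    simpa using (ZMod.intCast_zmod_eq_zero_iff_dvd r' N).mpr hNr
  · rw [hd] at hgd; exact_mod_cast hgd
  · exact Nat.isCoprime_iff_coprime.mp hgco
  · rw [hb] at hbd; exact_mod_cast hbd
  · rw [hb] at hdm
    ext i j
    fin_cases i <;> fin_cases j <;> simp [Matrix.mul_apply, Fin.sum_univ_two]
    · linear_combination hp
    · linear_combination -p' * hdm - v * hd - q * huv
    · linear_combination hr
    · linear_combination -r' * hdm + u * hd - s * huv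

lemma upper_unique {a b d a' b' d' : ℕ} (ha : 0 < a) (ha' : 0 < a') (hbd : b < d) (hbd' : b' < d')
    {δ : SL(2, ℤ)} (h : !![(a : ℤ), b; 0, d] =
      (δ : Matrix (Fin 2) (Fin 2) ℤ) * !![(a' : ℤ), b'; 0, d']) :
    a = a' ∧ b = b' ∧ d = d' := by
  have hdet : δ 0 0 * δ 1 1 - δ 0 1 * δ 1 0 = 1 := by
    have := δ.det_coe; rwa [Matrix.det_fin_two] at this
  have h00 := congr_fun₂ h 0 0
  have h01 := congr_fun₂ h 0 1
  have h10 := congr_fun₂ h 1 0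
  have h11 := congr_fun₂ h 1 1
  simp [Matrix.mul_apply, Fin.sum_univ_two] at h00 h01 h10 h11
  have hc : δ 1 0 = 0 := h10.resolve_right ha'.ne'
  rw [hc] at hdet h11
  simp at hdet h11
  have hpos : 0 < δ 0 0 := by
    have : (0 : ℤ) < δ 0 0 * a' := by rw [← h00]; exact_mod_cast ha
    exact pos_of_mul_pos_left this (by positivity)
  have h0 : δ 0 0 = 1 := by
    rcases Int.mul_eq_one_iff_eq_one_or_neg_one.mp hdet with h | h <;> omega
  rw [h0] at hdet h00 h01
  simp at hdet h00 h01
  rw [hdet] at h11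
  have hdd : d = d' := by simpa using h11
  subst hdd
  refine ⟨h00, ?_, rfl⟩
  have : δ 0 1 = 0 := by
    by_contra hne
    rcases lt_or_gt_of_ne hne with hl | hl <;> nlinarith
  rw [this] at h01
  simpa using h01

/-- An integral matrix of non-zero determinant, as an element of `GL(2, ℚ)`. -/
def toGLQ (M : Matrix (Fin 2) (Fin 2) ℤ) : GL (Fin 2) ℚ :=
  if h : (M.map (Int.cast : ℤ → ℚ)).det ≠ 0 then
    Matrix.GeneralLinearGroup.mkOfDetNeZero _ h else 1

lemma det_cast (M : Matrix (Fin 2) (Fin 2) ℤ) : (M.map (Int.cast : ℤ → ℚ)).det = M.det := by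
  simp [Matrix.det_fin_two]

lemma coe_toGLQ {M : Matrix (Fin 2) (Fin 2) ℤ} (h : M.det ≠ 0) :
    (toGLQ M : Matrix (Fin 2) (Fin 2) ℚ) = M.map (Int.cast : ℤ → ℚ) := by
  rw [toGLQ, dif_pos (by rw [det_cast]; exact_mod_cast h)]
  rfl

/-- An integral matrix of non-zero determinant, as an element of `GL(2, ℝ)`. -/
def toGLR (M : Matrix (Fin 2) (Fin 2) ℤ) : GL (Fin 2) ℝ := (toGLQ M).map (Rat.castHom ℝ)

lemma coe_toGLR {M : Matrix (Fin 2) (Fin 2) ℤ} (h : M.det ≠ 0) :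
    (toGLR M : Matrix (Fin 2) (Fin 2) ℝ) = M.map (Int.cast : ℤ → ℝ) := by
  ext i j
  simp [toGLR, coe_toGLQ h]

lemma toGLR_mul {A B : Matrix (Fin 2) (Fin 2) ℤ} (hA : A.det ≠ 0) (hB : B.det ≠ 0) :
    toGLR (A * B) = toGLR A * toGLR B := by
  apply Units.ext
  rw [Units.val_mul, coe_toGLR hA, coe_toGLR hB, coe_toGLR (by simp [hA, hB])]
  exact Matrix.map_mul_intCast A B

lemma toGLR_SL (γ : SL(2, ℤ)) :
    toGLR (γ : Matrix (Fin 2) (Fin 2) ℤ) = Matrix.SpecialLinearGroup.mapGL ℝ γ := by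
  apply Units.ext
  rw [coe_toGLR (by simp)]
  ext i j
  simp

lemma det_upper {a b d n : ℕ} (h : a * d = n) : (!![(a : ℤ), b; 0, d]).det = n := by
  simp [Matrix.det_fin_two_of, ← h]

/-- Indices `⟨(a, d), b⟩` of the upper triangular matrices in the formula for `Tₙ`. -/
def reps (N n : ℕ) : Finset (Σ _ : ℕ × ℕ, ℕ) :=
  {x ∈ n.divisorsAntidiagonal | x.1.Coprime N}.sigma fun x ↦ Finset.range x.2

/-- The upper triangular matrix `(a b; 0 d)`. -/
def repMat (x : Σ _ : ℕ × ℕ, ℕ) : Matrix (Fin 2) (Fin 2) ℤ := !![(x.1.1 : ℤ), x.2; 0, x.1.2]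

lemma mem_reps {N n : ℕ} {x : Σ _ : ℕ × ℕ, ℕ} : x ∈ reps N n ↔
    ((x.1.1 * x.1.2 = n ∧ n ≠ 0) ∧ x.1.1.Coprime N) ∧ x.2 < x.1.2 := by
  simp [reps]

lemma det_repMat {N n : ℕ} {x : Σ _ : ℕ × ℕ, ℕ} (hx : x ∈ reps N n) : (repMat x).det = n :=
  det_upper (mem_reps.mp hx).1.1.1

lemma det_repMat_ne {N n : ℕ} {x : Σ _ : ℕ × ℕ, ℕ} (hx : x ∈ reps N n) : (repMat x).det ≠ 0 := by
  rw [det_repMat hx]; exact_mod_cast (mem_reps.mp hx).1.1.2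

lemma heckeFun_eq (N n : ℕ) (f : ℍ → ℂ) :
    heckeFun N n f = ∑ x ∈ reps N n, f ∣[(2 : ℤ)] toGLR (repMat x) := by
  ext τ
  rw [heckeFun, Finset.sum_sigma', Finset.sum_apply]
  refine Finset.sum_congr rfl fun x hx ↦ ?_
  have hx' : x ∈ reps N n := hx
  obtain ⟨⟨⟨h1, h2⟩, -⟩, h3⟩ := mem_reps.mp hx'
  have hne := det_repMat_ne hx'
  have hdet : (toGLR (repMat x)).det.val = n := by
    rw [Matrix.GeneralLinearGroup.val_det_apply, coe_toGLR hne]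
    have := det_repMat hx'
    rw [Matrix.det_fin_two] at this ⊢
    simp only [Matrix.map_apply]
    exact_mod_cast this
  have hn : (0 : ℝ) < n := by exact_mod_cast Nat.pos_of_ne_zero h2
  have hpos : 0 < (toGLR (repMat x)).det.val := by rw [hdet]; exact hn
  have hden : denom (toGLR (repMat x)) τ = x.1.2 := by
    rw [denom, coe_toGLR hne]; simp [repMat]
  have hnum : num (toGLR (repMat x)) τ = x.1.1 * τ + x.2 := by
    rw [num, coe_toGLR hne]; simp [repMat]
  have hsm : toGLR (repMat x) • τ = ofComplex ((x.1.1 * τ + x.2) / x.1.2) := by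
    rw [← hnum, ← hden, ← coe_smul_of_det_pos hpos, ofComplex_apply]
  rw [slash_apply, hsm, hden, hdet, σ, if_pos hpos, abs_of_pos hn]
  simp only [ContinuousAlgEquiv.refl_apply]
  norm_num
  rw [div_eq_mul_inv]
  norm_cast
  ring

lemma heckeFun_slash {N n : ℕ} {f : ℍ → ℂ}
    (hf : ∀ γ ∈ Gamma0 N, f ∣[(2 : ℤ)] (Matrix.SpecialLinearGroup.mapGL ℝ γ) = f)
    {γ : SL(2, ℤ)} (hγ : γ ∈ Gamma0 N) :
    heckeFun N n f ∣[(2 : ℤ)] (Matrix.SpecialLinearGroup.mapGL ℝ γ) = heckeFun N n f := by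
  have key : ∀ x ∈ reps N n, ∃ y ∈ reps N n, ∃ γ' ∈ Gamma0 N,
      repMat x * γ.1 = γ'.1 * repMat y := by
    intro x hx
    obtain ⟨⟨⟨h1, h2⟩, h4⟩, h3⟩ := mem_reps.mp hx
    have hγN : (N : ℤ) ∣ γ 1 0 := (ZMod.intCast_zmod_eq_zero_iff_dvd _ N).mp (Gamma0_mem.mp hγ)
    obtain ⟨c, hc⟩ := hγN
    have hγdet : γ 0 0 * γ 1 1 - γ 0 1 * γ 1 0 = 1 := by
      have := γ.det_coe; rwa [Matrix.det_fin_two] at this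
    obtain ⟨γ', hγ', a, b, d, hab, hco, hbd, h⟩ := exists_decomp (N := N) (n := n)
      (M := repMat x * γ.1) (Nat.pos_of_ne_zero h2) (by simp [det_repMat hx])
      (by simp [repMat, Matrix.mul_apply, Fin.sum_univ_two, hc]; exact ⟨x.1.2 * c, by ring⟩)
      (by
        have e1 : IsCoprime (x.1.1 : ℤ) N := Nat.isCoprime_iff_coprime.mpr h4
        have e2 : IsCoprime (γ 0 0) (N : ℤ) :=
          ⟨γ 1 1, -(γ 0 1 * c), by rw [hc] at hγdet; linear_combination hγdet⟩
        have e3 := (e1.mul_left e2).add_mul_left_left (x.2 * c)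
        convert! e3 using 1
        simp [repMat, Matrix.mul_apply, Fin.sum_univ_two, hc]
        ring)
    exact ⟨⟨(a, d), b⟩, mem_reps.mpr ⟨⟨⟨hab, h2⟩, hco⟩, hbd⟩, γ', hγ', h⟩
  choose! φ hφ γ' hγ' hφe using key
  have hinj : Set.InjOn φ (reps N n) := by
    intro x hx y hy hxy
    have ex := hφe x hx
    have ey := hφe y hy
    rw [hxy] at ex
    have h1 : repMat x = (γ' x * (γ' y)⁻¹ : SL(2, ℤ)).1 * repMat y := by
      have hyy : repMat (φ y) = ((γ' y)⁻¹ : SL(2, ℤ)).1 * (repMat y * γ.1) := by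
        rw [ey, ← mul_assoc, ← Matrix.SpecialLinearGroup.coe_mul]; simp
      rw [hyy] at ex
      have : repMat x * γ.1 * (γ⁻¹ : SL(2, ℤ)).1 =
        (γ' x).1 * (((γ' y)⁻¹ : SL(2, ℤ)).1 * (repMat y * γ.1)) * (γ⁻¹ : SL(2, ℤ)).1 := by rw [ex]
      have hγγ : γ.1 * (γ⁻¹ : SL(2, ℤ)).1 = 1 := by
        rw [← Matrix.SpecialLinearGroup.coe_mul]; simp
      simp only [mul_assoc, hγγ, mul_one] at this
      rw [this, Matrix.SpecialLinearGroup.coe_mul, mul_assoc]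
    obtain ⟨⟨⟨hx1, hx2⟩, -⟩, hx3⟩ := mem_reps.mp hx
    obtain ⟨⟨⟨hy1, hy2⟩, -⟩, hy3⟩ := mem_reps.mp hy
    have hxa : 0 < x.1.1 := Nat.pos_of_ne_zero fun h ↦ hx2 (by rw [← hx1, h, zero_mul])
    have hya : 0 < y.1.1 := Nat.pos_of_ne_zero fun h ↦ hy2 (by rw [← hy1, h, zero_mul])
    obtain ⟨e1, e2, e3⟩ := upper_unique hxa hya hx3 hy3 h1
    obtain ⟨⟨xa, xd⟩, xb⟩ := x
    obtain ⟨⟨ya, yd⟩, yb⟩ := y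
    simp_all
  rw [heckeFun_eq, SlashAction.sum_slash]
  refine Finset.sum_nbij φ hφ hinj (Finset.surjOn_of_injOn_of_card_le φ hφ hinj le_rfl) ?_
  intro x hx
  rw [← SlashAction.slash_mul, ← toGLR_SL, ← toGLR_mul (det_repMat_ne hx) (by simp), hφe x hx,
    toGLR_mul (by simp) (det_repMat_ne (hφ x hx)), SlashAction.slash_mul, toGLR_SL,
    hf _ (hγ' x hx)]

lemma heckeFun_isZeroAt {N n : ℕ} [NeZero N] (f : S2 N) {c : OnePoint ℝ}
    (hc : IsCusp c (Gamma0 N : Subgroup (GL (Fin 2) ℝ))) : c.IsZeroAt (heckeFun N n f) 2 := by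
  rw [heckeFun_eq]
  refine Finset.sum_induction _ (fun F ↦ c.IsZeroAt F 2) (fun _ _ h h' ↦ h.add h') ?_ ?_
  · intro g _
    rw [SlashAction.zero_slash]
    exact Filter.zero_zeroAtFilter _
  · intro x _
    rw [← OnePoint.IsZeroAt.smul_iff]
    apply f.zero_at_cusps'
    rw [Subgroup.IsArithmetic.isCusp_iff_isCusp_SL2Z, isCusp_SL2Z_iff] at hc ⊢
    obtain ⟨c', rfl⟩ := hc
    refine ⟨toGLQ (repMat x) • c', ?_⟩
    rw [← Rat.coe_castHom, OnePoint.map_smul]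
    rfl

end HeckeWellDefined

/-- The cusp form `Tₙ f`. -/
def heckeForm (N : ℕ) [NeZero N] (n : ℕ) (f : S2 N) : S2 N where
  toFun := heckeFun N n f
  slash_action_eq' := by
    rintro _ ⟨γ, hγ, rfl⟩
    exact heckeFun_slash (fun δ hδ ↦ f.slash_action_eq' _ ⟨δ, hδ, rfl⟩) hγ
  holo' := by
    change MDiff (heckeFun N n f)
    rw [heckeFun_eq]
    exact Finset.sum_induction _ (fun F : ℍ → ℂ ↦ MDiff F) (fun _ _ h h' ↦ h.add h')
      mdifferentiable_const fun x _ ↦ f.holo'.slash 2 _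
  zero_at_cusps' := heckeFun_isZeroAt f

/-- The Hecke operator `Tₙ` as an endomorphism of `S₂(Γ₀(N))`. -/
def heckeT (N : ℕ) [NeZero N] (n : ℕ) : Module.End ℂ (S2 N) where
  toFun := heckeForm N n
  map_add' f g := by
    ext τ
    change heckeFun N n (f + g) τ = heckeFun N n f τ + heckeFun N n g τ
    simp [heckeFun, mul_add, Finset.sum_add_distrib]
  map_smul' c f := by
    ext τ
    change heckeFun N n (c • f) τ = c * heckeFun N n f τ
    simp [heckeFun, Finset.mul_sum, mul_left_comm]

section Petersson
open MeasureTheory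

lemma volume_fd_lt_top : volume ModularGroup.fd < ⊤ := by
  rw [volume_eq_lintegral]
  let S : Set (ℝ × ℝ) := Set.Icc (-1) 1 ×ˢ Set.Ioi (1 / 2)
  have hsub : (UpperHalfPlane.coe '' ModularGroup.fd) ⊆ Complex.measurableEquivRealProd ⁻¹' S := by
    rintro _ ⟨τ, hτ, rfl⟩
    have h3 := ModularGroup.three_le_four_mul_im_sq_of_mem_fd hτ
    have h4 := abs_le.mp hτ.2
    have h5 := τ.im_pos
    refine ⟨⟨?_, ?_⟩, ?_⟩
    · change -1 ≤ τ.re; linarith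
    · change τ.re ≤ 1; linarith
    · change 1 / 2 < τ.im; nlinarith
  refine (lintegral_mono_set hsub).trans_lt ?_
  have hpre : ∫⁻ z : ℂ in Complex.measurableEquivRealProd ⁻¹' S,
      ↑((1 / ‖z.im‖₊) ^ 2 : NNReal) =
      ∫⁻ p : ℝ × ℝ in S, ↑((1 / ‖p.2‖₊) ^ 2 : NNReal) :=
    Complex.volume_preserving_equiv_real_prod.setLIntegral_comp_preimage_emb
      Complex.measurableEquivRealProd.measurableEmbedding
      (fun p : ℝ × ℝ ↦ (↑((1 / ‖p.2‖₊) ^ 2 : NNReal) : ENNReal)) S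
  rw [hpre, Measure.volume_eq_prod, ← Measure.prod_restrict]
  rw [lintegral_prod _ (by fun_prop)]
  simp only [lintegral_const]
  refine ENNReal.mul_lt_top ?_ (by simp)
  have hint : IntegrableOn (fun y : ℝ ↦ y ^ (-2 : ℝ)) (Set.Ioi (1 / 2)) :=
    integrableOn_Ioi_rpow_of_lt (by norm_num) (by norm_num)
  refine lt_of_le_of_lt ?_ hint.2
  refine setLIntegral_mono' measurableSet_Ioi fun y hy ↦ le_of_eq ?_
  have hy0 : 0 < y := lt_trans (by norm_num) hy
  rw [enorm_eq_nnnorm]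
  congr 1
  ext
  rw [coe_nnnorm, Real.norm_of_nonneg (by positivity)]
  change _ = y ^ (-2 : ℝ)
  rw [Real.rpow_neg hy0.le]
  simp

lemma integrableOn_petersson {N : ℕ} [NeZero N] (f g : S2 N) (γ : SL(2, ℤ)) :
    IntegrableOn (fun τ : ℍ ↦ petersson 2 f g (γ • τ)) ModularGroup.fd := by
  obtain ⟨C, hC⟩ := CuspFormClass.petersson_bounded_left 2
    (Gamma0 N : Subgroup (GL (Fin 2) ℝ)) f g
  have hcont : Continuous fun τ : ℍ ↦ petersson 2 f g (γ • τ) :=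
    (petersson_continuous 2 (ModularFormClass.continuous f)
      (ModularFormClass.continuous g)).comp (continuous_const_smul (Matrix.SpecialLinearGroup.mapGL ℝ γ))
  exact Measure.integrableOn_of_bounded (M := C) volume_fd_lt_top.ne
    hcont.aestronglyMeasurable (.of_forall fun τ ↦ hC _)

end Petersson

open MeasureTheory in
/-- The Petersson inner product on `S₂(Γ₀(N))`: the integral of `conj (f τ) * g τ * (im τ) ^ 2`
against the invariant measure `dx dy / y ^ 2` over a fundamental domain of `Γ₀(N)`, namely the union
of the translates by coset representatives of `Γ₀(N)` of the standard fundamental domain of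
`SL(2, ℤ)`. -/
def peterssonInner {N : ℕ} (f g : S2 N) : ℂ :=
  ∑ᶠ q : SL(2, ℤ) ⧸ Gamma0 N, ∫ τ in ModularGroup.fd, petersson 2 f g (q.out⁻¹ • τ)

lemma peterssonInner_add {N : ℕ} [NeZero N] (f g h : S2 N) :
    peterssonInner f (g + h) = peterssonInner f g + peterssonInner f h := by
  rw [peterssonInner, peterssonInner, peterssonInner,
    ← finsum_add_distrib (Set.toFinite _) (Set.toFinite _)]
  refine finsum_congr fun q ↦ ?_
  rw [← MeasureTheory.integral_add (integrableOn_petersson f g _) (integrableOn_petersson f h _)]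
  simp [petersson, mul_add, add_mul]

lemma peterssonInner_smul {N : ℕ} [NeZero N] (f g : S2 N) (c : ℂ) :
    peterssonInner f (c • g) = c * peterssonInner f g := by
  rw [peterssonInner, peterssonInner, mul_finsum]
  refine finsum_congr fun q ↦ ?_
  rw [← MeasureTheory.integral_const_mul]
  simp [petersson, mul_left_comm, mul_assoc]

/-- `g ↦ ⟨f, g⟩` as a linear functional. -/
def peterssonLinear {N : ℕ} [NeZero N] (f : S2 N) : S2 N →ₗ[ℂ] ℂ where
  toFun := peterssonInner f
  map_add' := peterssonInner_add f
  map_smul' c g := peterssonInner_smul f g c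

/-- The `n`-th Fourier coefficient at the cusp `∞`. -/
def fourierCoeff {N : ℕ} (f : S2 N) (n : ℕ) : ℂ := (qExpansion 1 f).coeff n

lemma fourierCoeff_add {N : ℕ} (f g : S2 N) (n : ℕ) :
    fourierCoeff (f + g) n = fourierCoeff f n + fourierCoeff g n := by
  have h1 : (1 : ℝ) ∈ (Gamma0 N : Subgroup (GL (Fin 2) ℝ)).strictPeriods := by simp
  rw [fourierCoeff, FunLike.coe_add, ModularForm.qExpansion_add one_pos h1, map_add]
  rfl

lemma fourierCoeff_smul {N : ℕ} (c : ℂ) (f : S2 N) (n : ℕ) :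
    fourierCoeff (c • f) n = c * fourierCoeff f n := by
  have h1 : (1 : ℝ) ∈ (Gamma0 N : Subgroup (GL (Fin 2) ℝ)).strictPeriods := by simp
  rw [fourierCoeff, FunLike.coe_smul, ModularForm.qExpansion_smul one_pos h1, map_smul]
  rfl

/-- The `n`-th Fourier coefficient as a linear functional. -/
def fourierCoeffLinear (N n : ℕ) : S2 N →ₗ[ℂ] ℂ where
  toFun f := fourierCoeff f n
  map_add' f g := fourierCoeff_add f g n
  map_smul' c f := fourierCoeff_smul c f n

/-- `S₂(Γ₀(N), ℤ)`: the cusp forms all of whose Fourier coefficients are integers. -/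
def integralCuspForms (N : ℕ) : Submodule ℤ (S2 N) where
  carrier := {f | ∀ n, ∃ c : ℤ, fourierCoeff f n = c}
  add_mem' {f g} hf hg n := by
    obtain ⟨a, ha⟩ := hf n
    obtain ⟨b, hb⟩ := hg n
    exact ⟨a + b, by rw [fourierCoeff_add, ha, hb]; push_cast; rfl⟩
  zero_mem' n := ⟨0, by simpa [fourierCoeffLinear] using (fourierCoeffLinear N n).map_zero⟩
  smul_mem' c f hf n := by
    obtain ⟨a, ha⟩ := hf n
    refine ⟨c * a, ?_⟩
    have h : fourierCoeff (c • f) n = c • fourierCoeff f n :=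
      map_zsmul (fourierCoeffLinear N n) c f
    rw [h, ha]
    simp

/-- The space of oldforms in `S₂(Γ₀(N))`, spanned by all `g(dτ)`, where `g ∈ S₂(Γ₀(M))`, `M` is a
proper divisor of `N` and `d` divides `N / M`. -/
def oldforms (N : ℕ) : Submodule ℂ (S2 N) :=
  Submodule.span ℂ {h | ∃ M d : ℕ, M ≠ N ∧ M * d ∣ N ∧
    ∃ g : S2 M, ∀ τ : ℍ, h τ = g (ofComplex (d * τ))}

/-- `f` is a newform of weight two and level `Γ₀(N)`: it is orthogonal to all oldforms, it is an
eigenvector of every Hecke operator `Tₙ`, and its first Fourier coefficient is `1`. -/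
structure IsNewform {N : ℕ} [NeZero N] (f : S2 N) : Prop where
  new : ∀ h ∈ oldforms N, peterssonInner f h = 0
  eigen : ∀ n : ℕ, 0 < n → ∃ c : ℂ, heckeT N n f = c • f
  normalized : fourierCoeff f 1 = 1

/-- `f` is the newform attached to the elliptic curve `E` over `ℚ`: it is a newform whose Fourier
coefficients are the coefficients of the Hasse-Weil `L`-function of `E`. -/
structure IsNewformOf (E : WeierstrassCurve ℚ) {N : ℕ} [NeZero N] (f : S2 N) : Prop extends
    IsNewform f where
  coeff_eq : ∀ n : ℕ, fourierCoeff f n = E.LFunction n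

/-- The Hecke algebra of level `Γ₀(N)`: the subring of `End S₂(Γ₀(N))` generated by the `Tₙ`,
`n ≥ 1`. -/
def heckeAlgebra (N : ℕ) [NeZero N] : Subalgebra ℤ (Module.End ℂ (S2 N)) :=
  Algebra.adjoin ℤ {T | ∃ n : ℕ, 0 < n ∧ T = heckeT N n}

/-- The ideal `I_f` of the elements of the Hecke algebra that annihilate `f`. -/
def heckeAnnihilator {N : ℕ} [NeZero N] (f : S2 N) : Ideal (heckeAlgebra N) where
  carrier := {T | T.1 f = 0}
  add_mem' {T U} hT hU := by
    change (T.1 + U.1) f = 0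
    rw [LinearMap.add_apply, show T.1 f = 0 from hT, show U.1 f = 0 from hU, add_zero]
  zero_mem' := rfl
  smul_mem' T U hU := by
    change T.1 (U.1 f) = 0
    rw [show U.1 f = 0 from hU, map_zero]

/-- `S₂(Γ₀(N), ℤ)[I]`: the integral cusp forms annihilated by all elements of `I`. -/
def integralTorsion {N : ℕ} [NeZero N] (I : Ideal (heckeAlgebra N)) :
    Submodule ℤ (integralCuspForms N) where
  carrier := {g | ∀ T ∈ I, T.1 g.1 = 0}
  add_mem' {g h} hg hh T hT := by
    change T.1 (g.1 + h.1) = 0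
    rw [map_add, hg T hT, hh T hT, add_zero]
  zero_mem' T _ := T.1.map_zero
  smul_mem' c g hg T hT := by
    change T.1 (c • g.1) = 0
    rw [map_zsmul, hg T hT, smul_zero]

/-- The orthogonal complement, inside `S₂(Γ₀(N), ℤ)`, of a subgroup of `S₂(Γ₀(N), ℤ)` with respect
to the Petersson inner product. -/
def integralOrthogonal {N : ℕ} [NeZero N] (A : Submodule ℤ (integralCuspForms N)) :
    Submodule ℤ (integralCuspForms N) where
  carrier := {g | ∀ h ∈ A, peterssonInner h.1 g.1 = 0}
  add_mem' {g g'} hg hg' h hh := by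
    change peterssonInner h.1 (g.1 + g'.1) = 0
    rw [peterssonInner_add, hg h hh, hg' h hh, add_zero]
  zero_mem' h _ := (peterssonLinear h.1).map_zero
  smul_mem' c g hg h hh := by
    change peterssonLinear h.1 (c • g.1) = 0
    rw [map_zsmul, show peterssonLinear h.1 g.1 = 0 from hg h hh, smul_zero]

/-- The moduli `r` for which there is a cusp form with integral Fourier coefficients that is
orthogonal to `f` and congruent to `f` modulo `r`. -/
def congruenceModuli {N : ℕ} (f : S2 N) : Set ℕ :=
  {r | ∃ g ∈ integralCuspForms N, peterssonInner f g = 0 ∧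
    ∀ n : ℕ, ∃ c : ℤ, fourierCoeff f n - fourierCoeff g n = r * c}

/-- The congruence number of `f`: the greatest element of `congruenceModuli f`. -/
def congruenceNumber {N : ℕ} (f : S2 N) : ℕ := sSup (congruenceModuli f)

/-- The quotient `S₂(Γ₀(N), ℤ) / (S₂(Γ₀(N), ℤ)[I_f] ⊕ S₂(Γ₀(N), ℤ)[I_f]^⊥)`. -/
abbrev congruenceModule {N : ℕ} [NeZero N] (f : S2 N) : Type :=
  integralCuspForms N ⧸ (integralTorsion (heckeAnnihilator f) ⊔
    integralOrthogonal (integralTorsion (heckeAnnihilator f)))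

end CongruenceNumber

end

/-!
Let `φ(g) = ⟨f, g⟩` and let `L = S₂(Γ₀(N), ℤ)`. Everything follows from the existence of a
surjection `ψ : L → ℤ` and an integer `m ≥ 1` with `m φ(g) = ψ(g) φ(f)` on `L`
(`IsNewform.exists_integral_functional`), so `ψ(f) = m`. The torsion `L[I_f]` is `ℤ f`, because
`Tₙ - aₙ ∈ I_f` and `a₁(Tₙ g) = aₙ(g)`; its orthogonal complement is `ker ψ`; hence the quotient is
`ℤ / ψ(f) ℤ = ℤ / m ℤ`. If `f ≡ g` modulo `r` with `g ∈ ker ψ`, then `(f - g) / r ∈ L` and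
`m = r ψ((f - g) / r)`, so `r ∣ m`; and `r = m` is attained by `f - m h` with `ψ(h) = 1`.

The map `ψ` exists once `φ(L)` lies in `φ(f) ℚ` with bounded denominators, and this uses that `φ`
is an eigenvector of all Hecke operators: `φ(Tₙ g) = aₙ φ(g)` for all `n`. Write `φ = ∑ dₘ aₘ`, a
finite sum by a Sturm bound (`exists_sturm_bound`: the norm to level one reduces it to the known
case). For a `ℚ`-linear map `l : ℂ → ℚ` with `l(φ(f)) = 1`, the functional `l ∘ φ` on `L` is
`∑ l(dₙ) aₙ` and has the same eigenvalues. Evaluating `∑ l(dₙ) dₘ aₘ(Tₙ g)` in two ways by the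
symmetry `aₘ(Tₙ g) = aₙ(Tₘ g)` (`fourierCoeff_heckeT_comm`) gives `φ(g) = l(φ(g)) φ(f)` with
`l(φ(g)) = ∑ l(dₙ) aₙ(g)`, whose denominator is bounded (`IsNewform.exists_rational_functional`).

That `φ` is an eigenvector (`IsNewform.exists_peterssonInner_heckeT`) is reduced to prime index `p`
by `T_p T_n = T_{pn} + p T_{n/p}`. If `p ∤ N`, then `T_p` is self-adjoint. If `p ∣ N`, write
`N = p M` and consider the trace `Tr` to level `Γ₀(M)` of `g(τ / p)`, given by the integral
matrices of determinant `p` with lower left entry divisible by `N` and lower right entry divisible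
by `p`. Its values are oldforms, so `φ ∘ Tr = 0`, and its adjoint maps a form `t` of level `M` to a
multiple of `t(p τ)`, so `Tr f = 0` as well (`IsNewform.trace_eq_zero`). If `p ∣ M`, then
`Tr = T_p`. Otherwise `Tr g = T_p g + g | w` for an Atkin-Lehner matrix `w`, and `g ↦ g | w` is
self-adjoint, so that `⟨f, T_p g⟩ = -⟨f, g | w⟩ = -⟨f | w, g⟩` is a multiple of `⟨f, g⟩`.

All adjoints come from one statement (`IsLeftReps.sum_weightedInner_adjugate`): the adjoint of the
operator given by a set `S` of integral matrices, a union of left cosets of `Γ₀(N)`, is given by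
the adjugates of the elements of `S`. It is proved by unfolding. A weight `ω` on `ℍ` whose
`Γ₀(N)`-translates sum to `1` almost everywhere turns `⟨f, g⟩` into an integral over `ℍ`, and
`⟨f, T g⟩` into a sum over `M ∈ S` of integrals that involve `ω(τ) ω(M τ)`; the substitution of
`M τ` for `τ` then replaces `M` by its adjugate and exchanges `f` and `g`.
-/

open UpperHalfPlane ModularForm CongruenceSubgroup
open scoped MatrixGroups Manifold

namespace CongruenceNumber

/-! ### Fourier coefficients and Hecke operators -/

lemma one_mem_strictPeriods (N : ℕ) :
    (1 : ℝ) ∈ (Gamma0 N : Subgroup (GL (Fin 2) ℝ)).strictPeriods := by simp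

lemma hasSum_fourierCoeff {N : ℕ} [NeZero N] (f : S2 N) (τ : ℍ) :
    HasSum (fun m ↦ fourierCoeff f m * Function.Periodic.qParam 1 τ ^ m) (f τ) :=
  ModularForm.hasSum_qExpansion f one_pos (one_mem_strictPeriods N) τ

lemma fourierCoeff_eq_of_hasSum {N : ℕ} [NeZero N] {f : S2 N} {c : ℕ → ℂ}
    (h : ∀ τ : ℍ, HasSum (fun m ↦ c m * Function.Periodic.qParam 1 τ ^ m) (f τ)) (m : ℕ) :
    fourierCoeff f m = c m :=
  (ModularFormClass.qExpansion_coeff_unique one_pos (one_mem_strictPeriods N) h m).symm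

lemma fourierCoeff_ext {N : ℕ} [NeZero N] {f g : S2 N}
    (h : ∀ n, fourierCoeff f n = fourierCoeff g n) : f = g := by
  ext τ
  refine (hasSum_fourierCoeff f τ).unique ?_
  simpa only [h] using hasSum_fourierCoeff g τ

@[simp] lemma fourierCoeff_zero_right {N : ℕ} [NeZero N] (f : S2 N) : fourierCoeff f 0 = 0 :=
  CuspFormClass.qExpansion_coeff_zero f one_pos (one_mem_strictPeriods N)

lemma heckeT_apply (N : ℕ) [NeZero N] (n : ℕ) (f : S2 N) (τ : ℍ) :
    heckeT N n f τ = heckeFun N n f τ := rfl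

open Complex Function.Periodic in
/-- Only the coefficients with index divisible by `d` survive the average over `b`. -/
lemma sum_qParam_pow {a d : ℕ} (ha : 0 < a) (hd : 0 < d) (τ : ℍ) (k : ℕ) :
    ∑ b ∈ Finset.range d, qParam 1 (ofComplex ((a * τ + b) / d) : ℍ) ^ k =
      if d ∣ k then d * qParam 1 τ ^ (a * (k / d)) else 0 := by
  have hd0 : (d : ℂ) ≠ 0 := by exact_mod_cast hd.ne'
  have him : ∀ b : ℕ, 0 < ((a * τ + b) / d : ℂ).im := by
    intro b
    have : ((a * τ + b) / d : ℂ).im = a * τ.im / d := by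
      rw [← ofReal_natCast d, div_ofReal_im]; simp
    rw [this]
    have := τ.im_pos
    positivity
  have hq : ∀ b : ℕ, qParam 1 (ofComplex ((a * τ + b) / d) : ℍ) ^ k =
      exp (2 * Real.pi * Complex.I * (a * τ * k / d)) *
        exp (2 * Real.pi * Complex.I * (k / d)) ^ b := by
    intro b
    rw [ofComplex_apply_of_im_pos (him b), coe_mk, qParam, ← exp_nat_mul, ← exp_nat_mul, ← exp_add]
    congr 1
    push_cast
    field_simp
  simp only [hq, ← Finset.mul_sum]
  have hroot := Complex.isPrimitiveRoot_exp d hd.ne'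
  have hk : exp (2 * Real.pi * Complex.I * (k / d)) = exp (2 * Real.pi * Complex.I / d) ^ k := by
    rw [← exp_nat_mul]; congr 1; field_simp
  split_ifs with h
  · obtain ⟨j, rfl⟩ := h
    have h1 : exp (2 * Real.pi * Complex.I * ((d * j : ℕ) / d)) = 1 := by
      rw [hk, pow_mul, hroot.pow_eq_one, one_pow]
    simp only [h1, one_pow, Finset.sum_const, Finset.card_range, nsmul_eq_mul, mul_one]
    rw [Nat.mul_div_cancel_left _ hd, mul_comm, qParam, ← exp_nat_mul]
    congr 2
    push_cast
    field_simp
  · have h1 : exp (2 * Real.pi * Complex.I * (k / d)) ≠ 1 := by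
      rw [hk, Ne, hroot.pow_eq_one_iff_dvd]
      exact h
    have h2 : exp (2 * Real.pi * Complex.I * (k / d)) ^ d = 1 := by
      rw [hk, ← pow_mul, mul_comm k d, pow_mul, hroot.pow_eq_one, one_pow]
    rw [geom_sum_eq h1, h2]
    simp

lemma fourierCoeff_heckeT {N : ℕ} [NeZero N] (n : ℕ) (f : S2 N) (m : ℕ) :
    fourierCoeff (heckeT N n f) m = ∑ x ∈ n.divisorsAntidiagonal with x.1.Coprime N,
      if x.1 ∣ m then x.1 * fourierCoeff f (x.2 * (m / x.1)) else 0 := by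
  revert m
  refine fourierCoeff_eq_of_hasSum fun τ ↦ ?_
  rw [heckeT_apply, heckeFun]
  simp only [Finset.sum_mul]
  refine hasSum_sum fun x hx ↦ ?_
  obtain ⟨hx, -⟩ := Finset.mem_filter.mp hx
  obtain ⟨hxn, hn0⟩ := Nat.mem_divisorsAntidiagonal.mp hx
  obtain ⟨a, d⟩ := x
  dsimp only at hxn ⊢
  have ha : 0 < a := Nat.pos_of_ne_zero fun h ↦ hn0 (by rw [← hxn, h, zero_mul])
  have hd : 0 < d := Nat.pos_of_ne_zero fun h ↦ hn0 (by rw [← hxn, h, mul_zero])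
  have h1 : HasSum (fun k ↦ ∑ b ∈ Finset.range d, (n / (d : ℂ) ^ 2) * (fourierCoeff f k *
      Function.Periodic.qParam 1 (ofComplex ((a * τ + b) / d) : ℍ) ^ k))
      (∑ b ∈ Finset.range d, (n / (d : ℂ) ^ 2) * f (ofComplex ((a * τ + b) / d))) :=
    hasSum_sum fun b _ ↦ (hasSum_fourierCoeff f _).mul_left _
  simp only [← Finset.mul_sum, sum_qParam_pow ha hd] at h1 ⊢
  have hinjd : Function.Injective fun j : ℕ ↦ d * j := fun i j h ↦ Nat.eq_of_mul_eq_mul_left hd h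
  have hinja : Function.Injective fun j : ℕ ↦ a * j := fun i j h ↦ Nat.eq_of_mul_eq_mul_left ha h
  rw [← hinjd.hasSum_iff] at h1
  · rw [← hinja.hasSum_iff]
    · convert h1 using 1
      funext j
      simp only [Function.comp, dvd_mul_right, if_true, Nat.mul_div_cancel_left _ ha,
        Nat.mul_div_cancel_left _ hd]
      have hd0 : (d : ℂ) ≠ 0 := by exact_mod_cast hd.ne'
      rw [← hxn]
      push_cast
      field_simp
    · intro k hk
      rw [if_neg, zero_mul]
      rintro ⟨j, rfl⟩
      exact hk ⟨j, rfl⟩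
  · intro k hk
    rw [if_neg, mul_zero, mul_zero]
    rintro ⟨j, rfl⟩
    exact hk ⟨j, rfl⟩

lemma fourierCoeff_heckeT_eq_sum_divisors {N : ℕ} [NeZero N] {n m : ℕ} (f : S2 N)
    (hm : 0 < m) : fourierCoeff (heckeT N n f) m =
      ∑ a ∈ n.divisors with a ∣ m ∧ a.Coprime N, a * fourierCoeff f (m * n / (a * a)) := by
  rw [fourierCoeff_heckeT, Finset.sum_filter, Nat.sum_divisorsAntidiagonal (f := fun a d ↦
    if a.Coprime N then if a ∣ m then a * fourierCoeff f (d * (m / a)) else 0 else 0),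
    Finset.sum_filter]
  refine Finset.sum_congr rfl fun a ha ↦ ?_
  rw [← ite_and]
  refine ite_congr (propext and_comm) (fun h ↦ ?_) fun _ ↦ rfl
  obtain ⟨⟨d, rfl⟩, hn0⟩ := Nat.mem_divisors.mp ha
  obtain ⟨⟨j, rfl⟩, -⟩ := h
  have ha0 : 0 < a := Nat.pos_of_ne_zero fun h ↦ hn0 (by rw [h, zero_mul])
  rw [Nat.mul_div_cancel_left _ ha0, Nat.mul_div_cancel_left _ ha0,
    show a * j * (a * d) = (a * a) * (d * j) by ring, Nat.mul_div_cancel_left _ (mul_pos ha0 ha0)]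

@[simp] lemma heckeT_zero (N : ℕ) [NeZero N] (f : S2 N) : heckeT N 0 f = 0 := by
  ext τ
  simp [heckeT_apply, heckeFun]

@[simp] lemma fourierCoeff_zero_left {N : ℕ} (n : ℕ) : fourierCoeff (0 : S2 N) n = 0 :=
  (fourierCoeffLinear N n).map_zero

/-- The bilinear map `(Tₙ, f) ↦ a₁(Tₙ f)` behind the duality of Hecke operators and cusp forms
shows up here as a symmetry in `n` and `m`. -/
lemma fourierCoeff_heckeT_comm {N : ℕ} [NeZero N] (n m : ℕ) (f : S2 N) :
    fourierCoeff (heckeT N n f) m = fourierCoeff (heckeT N m f) n := by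
  rcases Nat.eq_zero_or_pos m with rfl | hm
  · simp
  rcases Nat.eq_zero_or_pos n with rfl | hn
  · simp
  rw [fourierCoeff_heckeT_eq_sum_divisors f hm, fourierCoeff_heckeT_eq_sum_divisors f hn]
  rw [mul_comm m n]
  refine Finset.sum_congr ?_ fun _ _ ↦ rfl
  ext a
  simp only [Finset.mem_filter, Nat.mem_divisors]
  grind

lemma fourierCoeff_one_heckeT {N : ℕ} [NeZero N] (n : ℕ) (f : S2 N) :
    fourierCoeff (heckeT N n f) 1 = fourierCoeff f n := by
  rw [fourierCoeff_heckeT_comm, fourierCoeff_heckeT]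
  simp [Finset.sum_filter]

lemma heckeT_one (N : ℕ) [NeZero N] : heckeT N 1 = 1 := by
  ext1 f
  refine fourierCoeff_ext fun n ↦ ?_
  rw [fourierCoeff_heckeT_comm, fourierCoeff_one_heckeT]
  rfl

lemma fourierCoeff_heckeT_prime {N : ℕ} [NeZero N] {p : ℕ} (hp : p.Prime) (f : S2 N) (k : ℕ) :
    fourierCoeff (heckeT N p f) k =
      fourierCoeff f (p * k) + if ¬ p ∣ N ∧ p ∣ k then p * fourierCoeff f (k / p) else 0 := by
  rw [fourierCoeff_heckeT, Finset.sum_filter, Nat.sum_divisorsAntidiagonal (f := fun a d ↦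
    if a.Coprime N then if a ∣ k then a * fourierCoeff f (d * (k / a)) else 0 else 0),
    hp.sum_divisors, add_comm]
  simp [hp.coprime_iff_not_dvd, ite_and, hp.pos]

/-- The divisors `a` of `(p k, n)` are split according to whether `p ∣ a`. -/
lemma fourierCoeff_mul_heckeT {N : ℕ} [NeZero N] {p : ℕ} (hp : p.Prime) (f : S2 N) {k n : ℕ}
    (hk : 0 < k) (hn : 0 < n) :
    fourierCoeff (heckeT N n f) (p * k) =
      (∑ a ∈ n.divisors with (a ∣ k ∧ a.Coprime N) ∧ ¬ p ∣ a,
        a * fourierCoeff f (p * (k * n) / (a * a))) +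
      if ¬ p ∣ N ∧ p ∣ n then p * fourierCoeff (heckeT N (n / p) f) k else 0 := by
  rw [fourierCoeff_heckeT_eq_sum_divisors f (Nat.mul_pos hp.pos hk),
    ← Finset.sum_filter_not_add_sum_filter _ (fun a ↦ p ∣ a), Finset.filter_filter,
    Finset.filter_filter]
  congr 1
  · refine Finset.sum_congr ?_ fun a _ ↦ by rw [mul_assoc]
    ext a
    simp only [Finset.mem_filter, Nat.mem_divisors]
    constructor
    · rintro ⟨h1, ⟨h2, h3⟩, h4⟩
      exact ⟨h1, ⟨((hp.coprime_iff_not_dvd.mpr h4).symm.dvd_of_dvd_mul_left h2), h3⟩, h4⟩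
    · rintro ⟨h1, ⟨h2, h3⟩, h4⟩
      exact ⟨h1, ⟨h2.mul_left p, h3⟩, h4⟩
  · split_ifs with h
    · obtain ⟨hpN, n, rfl⟩ := h
      rw [Nat.mul_div_cancel_left _ hp.pos, fourierCoeff_heckeT_eq_sum_divisors f hk,
        Finset.mul_sum]
      have hn' : n ≠ 0 := by rintro rfl; simp at hn
      symm
      refine Finset.sum_nbij (p * ·) ?_ ?_ ?_ ?_
      · intro a ha
        simp only [Finset.mem_filter, Nat.mem_divisors] at ha ⊢
        exact ⟨⟨mul_dvd_mul_left p ha.1.1, hn.ne'⟩, ⟨mul_dvd_mul_left p ha.2.1,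
          Nat.Coprime.mul_left (hp.coprime_iff_not_dvd.mpr hpN) ha.2.2⟩, dvd_mul_right _ _⟩
      · exact fun a _ b _ h ↦ Nat.eq_of_mul_eq_mul_left hp.pos h
      · intro b hb
        simp only [Finset.coe_filter, Set.mem_ofPred_eq, Nat.mem_divisors] at hb
        obtain ⟨⟨h1, -⟩, ⟨h2, h3⟩, a, rfl⟩ := hb
        refine ⟨a, ?_, rfl⟩
        simp only [Finset.coe_filter, Set.mem_ofPred_eq, Nat.mem_divisors]
        exact ⟨⟨Nat.dvd_of_mul_dvd_mul_left hp.pos h1, hn'⟩,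
          Nat.dvd_of_mul_dvd_mul_left hp.pos h2, h3.coprime_mul_left⟩
      · intro a _
        push_cast
        rw [mul_assoc, show p * k * (p * n) = (p * p) * (k * n) by ring,
          show p * a * (p * a) = (p * p) * (a * a) by ring,
          Nat.mul_div_mul_left _ _ (mul_pos hp.pos hp.pos)]
    · refine Finset.sum_eq_zero fun a ha ↦ ?_
      simp only [Finset.mem_filter, Nat.mem_divisors] at ha
      exfalso
      obtain ⟨⟨h1, -⟩, ⟨-, h3⟩, h4⟩ := ha
      refine h ⟨fun h5 ↦ ?_, h4.trans h1⟩
      exact Nat.not_coprime_of_dvd_of_dvd hp.one_lt h4 h5 h3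

/-- The relation `T_p T_n = T_{pn} + p T_{n/p}`, whose second term occurs only if `p ∤ N` and
`p ∣ n`. -/
lemma heckeT_mul_prime {N : ℕ} [NeZero N] {p : ℕ} (hp : p.Prime) {n : ℕ} (hn : 0 < n) (f : S2 N) :
    heckeT N p (heckeT N n f) = heckeT N (p * n) f +
      if ¬ p ∣ N ∧ p ∣ n then (p : ℂ) • heckeT N (n / p) f else 0 := by
  refine fourierCoeff_ext fun k ↦ ?_
  rcases Nat.eq_zero_or_pos k with rfl | hk
  · simp
  rw [fourierCoeff_heckeT_prime hp, fourierCoeff_add, fourierCoeff_mul_heckeT hp f hk hn,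
    fourierCoeff_heckeT_comm (p * n) k, fourierCoeff_mul_heckeT hp f hn hk,
    fourierCoeff_heckeT_comm n (k / p), apply_ite (fourierCoeff · k), fourierCoeff_smul,
    fourierCoeff_zero_left, add_right_comm]
  congr 2
  rw [mul_comm k n]
  refine Finset.sum_congr ?_ fun _ _ ↦ rfl
  ext a
  simp only [Finset.mem_filter, Nat.mem_divisors]
  grind

/-! ### A Sturm bound -/

section

open Filter Asymptotics

lemma isBigO_exp_of_fourierCoeff_eq_zero {N : ℕ} [NeZero N] {f : S2 N} {B : ℕ}
    (h : ∀ n < B, fourierCoeff f n = 0) :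
    (f : ℍ → ℂ) =O[atImInfty] fun τ ↦ Real.exp (-2 * Real.pi * B * τ.im) := by
  have hp := UpperHalfPlane.hasFPowerSeriesOnBall_cuspFunction (f := f) (c := fourierCoeff f)
    one_pos
    (ModularFormClass.analyticAt_cuspFunction_zero f one_pos (one_mem_strictPeriods N))
    (fun τ ↦ hasSum_fourierCoeff f τ)
  have h1 := hp.hasFPowerSeriesAt.isBigO_sub_partialSum_pow B
  have h2 := h1.comp_tendsto (qParam_tendsto_atImInfty one_pos)
  refine (h2.congr_left fun τ ↦ ?_).trans (.of_bound 1 (.of_forall fun τ ↦ ?_))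
  · have h3 : (FormalMultilinearSeries.ofScalars ℂ (fourierCoeff f)).partialSum B
        (Function.Periodic.qParam 1 τ) = 0 := by
      refine Finset.sum_eq_zero fun n hn ↦ ?_
      rw [FormalMultilinearSeries.ofScalars_apply_eq, h n (Finset.mem_range.mp hn), zero_smul]
    simp only [Function.comp, zero_add, h3, sub_zero]
    exact SlashInvariantFormClass.eq_cuspFunction f τ (one_mem_strictPeriods N) one_ne_zero
  · simp only [Function.comp, Function.Periodic.norm_qParam, ← Real.exp_nat_mul]
    rw [Real.norm_of_nonneg (Real.exp_nonneg _), Real.norm_of_nonneg (Real.exp_nonneg _), one_mul]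
    refine (congrArg Real.exp ?_).le
    simp
    ring

/-- The coefficients are integrals over horocycles; let the height of the horocycle grow. -/
lemma qExpansion_coeff_eq_zero_of_isBigO {k : ℤ} (F : ModularForm 𝒮ℒ k) {B : ℕ}
    (h : (F : ℍ → ℂ) =O[atImInfty] fun τ ↦ Real.exp (-2 * Real.pi * B * τ.im)) {n : ℕ}
    (hn : n < B) : (qExpansion 1 F).coeff n = 0 := by
  obtain ⟨C, hC⟩ := h.bound
  obtain ⟨A, hA⟩ := (atImInfty_mem _).mp hC
  have key : ∀ t : ℝ, 0 < t → A ≤ t → ‖(qExpansion 1 F).coeff n‖ ≤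
      C * Real.exp (-(2 * Real.pi * (B - n)) * t) := by
    intro t ht hAt
    rw [ModularFormClass.qExpansion_coeff_eq_intervalIntegral F one_pos (by simp) n ht]
    simp only [Complex.ofReal_one, div_one, one_mul]
    refine (intervalIntegral.norm_integral_le_of_norm_le_const
      (C := C * Real.exp (-(2 * Real.pi * (B - n)) * t)) fun u _ ↦ ?_).trans (by simp)
    have h1 := hA ⟨u + t * Complex.I, by simpa using ht⟩ (by simpa [UpperHalfPlane.im] using hAt)
    simp only [Set.mem_ofPred_eq] at h1
    rw [norm_mul, norm_div, norm_pow, Function.Periodic.norm_qParam, norm_one]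
    have h2 : (⟨u + t * Complex.I, by simpa using ht⟩ : ℍ).im = t := by simp [UpperHalfPlane.im]
    rw [h2, Real.norm_of_nonneg (Real.exp_nonneg _)] at h1
    refine (mul_le_mul_of_nonneg_left h1 (by positivity)).trans (le_of_eq ?_)
    rw [one_div, ← Real.exp_nat_mul, ← Real.exp_neg, mul_left_comm, ← Real.exp_add]
    congr 2
    simp
    ring
  have hpos : 0 < 2 * Real.pi * (B - n) :=
    mul_pos (by positivity) (by rw [sub_pos]; exact_mod_cast hn)
  have hlim : Tendsto (fun t : ℝ ↦ C * Real.exp (-(2 * Real.pi * (B - n)) * t)) atTop (nhds 0) := by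
    have := (Real.tendsto_exp_atBot.comp (tendsto_id.const_mul_atTop_of_neg
      (neg_lt_zero.mpr hpos))).const_mul C
    simpa using this
  have := ge_of_tendsto hlim (eventually_atTop.mpr ⟨max A 1, fun t ht ↦
    key t (lt_of_lt_of_le one_pos ((le_max_right _ _).trans ht)) ((le_max_left _ _).trans ht)⟩)
  simpa using this

/-- A Sturm bound for `S₂(Γ₀(N))`: it is reduced to level one by taking norms. -/
lemma exists_sturm_bound (N : ℕ) [NeZero N] :
    ∃ B : ℕ, ∀ f : S2 N, (∀ n < B, fourierCoeff f n = 0) → f = 0 := by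
  let 𝒢 : Subgroup (GL (Fin 2) ℝ) := Gamma0 N
  let 𝒬 := 𝒮ℒ ⧸ 𝒢.subgroupOf 𝒮ℒ
  let k : ℤ := 2 * Nat.card 𝒬
  refine ⟨k.toNat / 12 + 1, fun f hf ↦ ?_⟩
  have h0 : ModularForm.norm 𝒮ℒ f = 0 := by
    refine ModularForm.sturm_bound_levelOne ?_
    refine lt_of_lt_of_le (b := ((k.toNat / 12 + 1 : ℕ) : ℕ∞))
      (by exact_mod_cast Nat.lt_succ_self _)
      (PowerSeries.nat_le_order _ _ fun n hn ↦ ?_)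
    refine qExpansion_coeff_eq_zero_of_isBigO _ ?_ hn
    rw [ModularForm.coe_norm]
    let := Fintype.ofFinite 𝒬
    classical
    -- The factors of the norm other than `f` itself are translates of `f`, bounded at infinity.
    have h2 : (∏ q ∈ Finset.univ.erase (⟦1⟧ : 𝒬), SlashInvariantForm.quotientFunc f q)
        =O[atImInfty] (fun _ ↦ (1 : ℝ)) := by
      rw [show (fun _ : ℍ ↦ (1 : ℝ)) = fun x ↦ ∏ i ∈ Finset.univ.erase (⟦1⟧ : 𝒬), 1 by simp,
        Finset.prod_fn]
      refine .finsetProd fun q _ ↦ ?_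
      induction q using Quotient.inductionOn with
      | h r =>
        obtain ⟨r, hr⟩ := r
        have hb := (ModularForm.translate f r⁻¹).bdd_at_cusps' (c := OnePoint.infty)
          (by simpa using (Fact.out : IsCusp OnePoint.infty 𝒮ℒ).of_isFiniteRelIndex_conj hr) 1
          (by simp)
        simp only [SlashInvariantForm.toFun_eq_coe, ModularForm.toSlashInvariantForm_coe,
          SlashAction.slash_one] at hb
        exact hb
    have h3 := (isBigO_exp_of_fourierCoeff_eq_zero hf).mul h2
    refine (h3.congr_left fun τ ↦ ?_).congr_right fun τ ↦ mul_one _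
    have h4 := congr_fun (Finset.mul_prod_erase Finset.univ
      (fun q : 𝒬 ↦ SlashInvariantForm.quotientFunc f q) (Finset.mem_univ ⟦1⟧)) τ
    refine Eq.trans (congrArg (· * _) ?_) h4
    exact (congr_fun (by simp : (f : ℍ → ℂ) = ⇑f ∣[(2 : ℤ)] ((1 : 𝒮ℒ) : GL (Fin 2) ℝ)⁻¹) τ)
  rw [ModularForm.norm_eq_zero_iff] at h0
  exact DFunLike.coe_injective h0

end

/-! ### A weight that unfolds integrals over a fundamental domain -/

section

open MeasureTheory Matrix.SpecialLinearGroup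

instance : Countable SL(2, ℤ) :=
  have : Countable (Matrix (Fin 2) (Fin 2) ℤ) := inferInstanceAs (Countable (Fin 2 → Fin 2 → ℤ))
  Subtype.countable

lemma measurePreserving_smul_SL (γ : SL(2, ℤ)) :
    MeasurePreserving (fun τ : ℍ ↦ γ • τ) volume volume :=
  measurePreserving_smul (M := GL (Fin 2) ℝ) (mapGL ℝ γ) volume

instance : (volume : Measure ℍ).IsOpenPosMeasure where
  open_pos U hU hne h0 := by
    have h1 : (volume.comap UpperHalfPlane.coe) ≪ (volume : Measure ℍ) := by
      rw [UpperHalfPlane.volume_def]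
      refine withDensity_absolutelyContinuous' ?_ (.of_forall fun τ ↦ ?_)
      · refine Measurable.aemeasurable (Continuous.measurable ?_)
        refine ENNReal.continuous_coe.comp (.pow (.div₀ continuous_const ?_ ?_) _)
        · exact continuous_im.subtype_mk _
        · exact fun x ↦ NNReal.ne_iff.mp x.im_ne_zero
      · have : NNReal.mk τ.im⁻¹ (inv_pos.mpr τ.im_pos).le ≠ 0 :=
          NNReal.ne_iff.mp (inv_ne_zero τ.im_ne_zero)
        simpa using this
    have h2 := h1 h0
    rw [measurableEmbedding_coe.comap_apply] at h2
    exact (isOpenEmbedding_coe.isOpenMap U hU).measure_ne_zero volume (hne.image _) h2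

lemma measurableSet_fd : MeasurableSet ModularGroup.fd := by
  refine IsClosed.measurableSet (IsClosed.inter ?_ ?_)
  · exact isClosed_le continuous_const (Complex.continuous_normSq.comp continuous_coe)
  · exact isClosed_le (continuous_re.abs) continuous_const

lemma volume_fd_diff_fdo : volume (ModularGroup.fd \ ModularGroup.fdo) = 0 := by
  rw [volume_eq_lintegral]
  refine setLIntegral_measure_zero _ _ ?_
  have hre : ∀ c : ℝ, volume {z : ℂ | z.re = c} = 0 := by
    intro c
    have : {z : ℂ | z.re = c} = Complex.measurableEquivRealProd ⁻¹' ({c} ×ˢ Set.univ) := by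
      ext z; simp
    rw [this, Complex.volume_preserving_equiv_real_prod.measure_preimage_equiv,
      Measure.volume_eq_prod, Measure.prod_prod]
    simp
  refine measure_mono_null (t := Metric.sphere 0 1 ∪ ({z : ℂ | z.re = 1 / 2} ∪
    {z : ℂ | z.re = -(1 / 2)})) ?_ (measure_union_null (Measure.addHaar_sphere _ _ _)
    (measure_union_null (hre _) (hre _)))
  rintro _ ⟨τ, ⟨⟨h1, h2⟩, h3⟩, rfl⟩
  by_cases h4 : Complex.normSq (τ : ℂ) = 1
  · left
    rw [mem_sphere_zero_iff_norm, ← sq_eq_sq₀ (norm_nonneg _) zero_le_one,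
      ← Complex.normSq_eq_norm_sq, h4, one_pow]
  · right
    have h5 : |τ.re| = 1 / 2 := by
      by_contra h
      exact h3 ⟨lt_of_le_of_ne h1 (Ne.symm h4), lt_of_le_of_ne h2 h⟩
    exact (abs_eq (by norm_num)).mp h5

lemma eq_one_or_neg_one_of_mem_fdo {g : SL(2, ℤ)} {τ : ℍ} (h : τ ∈ ModularGroup.fdo)
    (hg : g • τ ∈ ModularGroup.fd) : g = 1 ∨ g = -1 := by
  have h1 : ‖(τ : ℂ)‖ ≠ 1 := by
    intro h2
    have := h.1
    rw [Complex.normSq_eq_norm_sq, h2] at this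
    norm_num at this
  have h2 := abs_lt.mp h.2
  have hρ : τ ≠ ρ := by
    rintro rfl; norm_num [ρ] at h2
  have hρ' : τ ≠ (1 : ℝ) +ᵥ ρ := by
    rintro rfl; norm_num [ρ] at h2
  have h3 : τ.re ≠ -1 / 2 := by intro h; rw [h] at h2; norm_num at h2
  have h4 : τ.re ≠ 1 / 2 := by intro h; rw [h] at h2; norm_num at h2
  have := ModularGroup.cases_of_mem_fd_smul_mem_fd (ModularGroup.fdo_subset_fd h) hg
  tauto

/-- Almost every point is carried into the standard fundamental domain by exactly two elements `±γ`
of `SL(2, ℤ)`. -/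
lemma ae_hasSum_indicator_fd : ∀ᵐ τ : ℍ,
    HasSum (fun δ : SL(2, ℤ) ↦ ModularGroup.fd.indicator (fun _ ↦ (1 / 2 : ℝ)) (δ • τ)) 1 := by
  have h : ∀ᵐ τ : ℍ, ∀ δ : SL(2, ℤ), δ • τ ∉ ModularGroup.fd \ ModularGroup.fdo := by
    rw [ae_all_iff]
    intro δ
    have h1 : ∀ᵐ τ : ℍ, τ ∉ ModularGroup.fd \ ModularGroup.fdo :=
      measure_eq_zero_iff_ae_notMem.mp volume_fd_diff_fdo
    have h2 := (measurePreserving_smul_SL δ).quasiMeasurePreserving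
    have h3 := h2.tendsto_ae.eventually h1
    exact h3
  filter_upwards [h] with τ hτ
  obtain ⟨δ, hδ⟩ := ModularGroup.exists_smul_mem_fd τ
  have hδo : δ • τ ∈ ModularGroup.fdo := by
    by_contra h'
    exact hτ δ ⟨hδ, h'⟩
  have hne : δ ≠ -δ := by
    intro h'
    have h0 : δ.1 = -δ.1 := congrArg Subtype.val h'
    have h00 : δ.1 = 0 := by
      ext i j
      have := congr_fun₂ h0 i j
      simp at this ⊢
      omega
    have := δ.2
    rw [h00] at this
    simp at this
  have hδ' : -δ • τ ∈ ModularGroup.fd := by rwa [ModularGroup.SL_neg_smul]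
  convert hasSum_sum_of_ne_finset_zero (s := {δ, -δ}) (f := fun δ : SL(2, ℤ) ↦
    ModularGroup.fd.indicator (fun _ ↦ (1 / 2 : ℝ)) (δ • τ)) ?_ using 1
  · rw [Finset.sum_pair hne, Set.indicator_of_mem hδ, Set.indicator_of_mem hδ']
    norm_num
  · intro ε hε
    refine Set.indicator_of_notMem (fun hε' ↦ hε ?_) _
    have h1 : (ε * δ⁻¹) • (δ • τ) ∈ ModularGroup.fd := by rwa [smul_smul, inv_mul_cancel_right]
    rcases eq_one_or_neg_one_of_mem_fdo hδo h1 with h2 | h2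
    · rw [mul_inv_eq_one] at h2
      simp [h2]
    · rw [mul_inv_eq_iff_eq_mul, neg_one_mul] at h2
      simp [h2]
  · infer_instance

/-- Half the number of the chosen coset representatives of `Γ₀(N)` that carry `τ` into the standard
fundamental domain of `SL(2, ℤ)`. The sum of its translates by `Γ₀(N)` is `1` almost everywhere, so
that integrals over a fundamental domain of `Γ₀(N)` become integrals over `ℍ` against this
weight. -/
noncomputable def fdWeight (N : ℕ) (τ : ℍ) : ℝ :=
  ∑ᶠ q : SL(2, ℤ) ⧸ Gamma0 N, ModularGroup.fd.indicator (fun _ ↦ (1 / 2 : ℝ)) (q.out • τ)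

lemma fdWeight_nonneg (N : ℕ) (τ : ℍ) : 0 ≤ fdWeight N τ :=
  finsum_nonneg fun _ ↦ Set.indicator_nonneg (fun _ _ ↦ by norm_num) _

lemma fdWeight_eq_sum {N : ℕ} [Fintype (SL(2, ℤ) ⧸ Gamma0 N)] (τ : ℍ) : fdWeight N τ =
    ∑ q : SL(2, ℤ) ⧸ Gamma0 N, ModularGroup.fd.indicator (fun _ ↦ (1 / 2 : ℝ)) (q.out • τ) :=
  finsum_eq_sum_of_fintype _

variable {N : ℕ} [NeZero N]

lemma measurable_fdWeight : Measurable (fdWeight N) := by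
  have := Fintype.ofFinite (SL(2, ℤ) ⧸ Gamma0 N)
  rw [funext (fdWeight_eq_sum (N := N))]
  exact Finset.measurable_sum _ fun q _ ↦
    (measurable_const.indicator measurableSet_fd).comp (measurePreserving_smul_SL _).measurable

lemma exists_fdWeight_le : ∃ C, ∀ τ, fdWeight N τ ≤ C := by
  have := Fintype.ofFinite (SL(2, ℤ) ⧸ Gamma0 N)
  refine ⟨∑ q : SL(2, ℤ) ⧸ Gamma0 N, (1 / 2 : ℝ), fun τ ↦ ?_⟩
  rw [fdWeight_eq_sum]
  exact Finset.sum_le_sum fun q _ ↦ Set.indicator_le_self' (fun _ _ ↦ by norm_num) _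

lemma ae_hasSum_fdWeight :
    ∀ᵐ τ : ℍ, HasSum (fun γ : Gamma0 N ↦ fdWeight N (γ.1 • τ)) 1 := by
  have := Fintype.ofFinite (SL(2, ℤ) ⧸ Gamma0 N)
  filter_upwards [ae_hasSum_indicator_fd] with τ hτ
  let e : Gamma0 N × (SL(2, ℤ) ⧸ Gamma0 N) ≃ SL(2, ℤ) := Equiv.ofBijective
    (fun x ↦ x.2.out * x.1.1) ⟨fun x y hxy ↦ by
      have h1 : x.2 = y.2 := by
        have h2 := congrArg (QuotientGroup.mk (s := Gamma0 N)) hxy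
        simpa [QuotientGroup.mk_mul_of_mem _ x.1.2, QuotientGroup.mk_mul_of_mem _ y.1.2] using h2
      refine Prod.ext (Subtype.ext ?_) h1
      dsimp only at hxy
      rw [h1] at hxy
      exact mul_left_cancel hxy, fun δ ↦ by
      have h1 : ((QuotientGroup.mk δ : SL(2, ℤ) ⧸ Gamma0 N).out)⁻¹ * δ ∈ Gamma0 N := by
        rw [← QuotientGroup.eq]; simp
      exact ⟨(⟨_, h1⟩, QuotientGroup.mk δ), by simp⟩⟩
  rw [← e.hasSum_iff] at hτ
  refine hτ.prod_fiberwise fun γ ↦ ?_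
  rw [fdWeight_eq_sum]
  convert hasSum_fintype _ using 3 with q
  exact congrArg _ (mul_smul _ _ _).symm

lemma integrable_fdWeight : Integrable (fdWeight N) := by
  have := Fintype.ofFinite (SL(2, ℤ) ⧸ Gamma0 N)
  rw [funext (fdWeight_eq_sum (N := N))]
  refine integrable_finsetSum _ fun q _ ↦ ?_
  have h1 : Integrable (ModularGroup.fd.indicator fun _ ↦ (1 / 2 : ℝ)) :=
    (integrable_indicator_iff measurableSet_fd).mpr (integrableOn_const volume_fd_lt_top.ne)
  have h2 := measurePreserving_smul_SL q.out
  have h3 := h2.integrable_comp_of_integrable h1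
  exact h3

lemma integrable_mul_fdWeight {F : ℍ → ℂ} (hF : AEStronglyMeasurable F) {C : ℝ}
    (hC : ∀ τ, ‖F τ‖ ≤ C) : Integrable fun τ ↦ F τ * fdWeight N τ :=
  integrable_fdWeight.ofReal.bdd_mul hF (.of_forall hC)

end

/-! ### The Petersson inner product as a weighted integral -/

section

open MeasureTheory Matrix.SpecialLinearGroup

section
variable {N : ℕ} [NeZero N]

/-- Each coset representative is moved from the form to the domain of integration. The factor `2`
makes up for the `1 / 2` in the weight, which accounts for `-1 ∈ Γ₀(N)`. -/
lemma peterssonInner_eq_integral (f g : S2 N) :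
    peterssonInner f g = 2 * ∫ τ, petersson 2 f g τ * fdWeight N τ := by
  have := Fintype.ofFinite (SL(2, ℤ) ⧸ Gamma0 N)
  have h1 : ∀ q : SL(2, ℤ) ⧸ Gamma0 N, ∀ τ : ℍ, petersson 2 f g τ *
      (ModularGroup.fd.indicator (fun _ ↦ (1 / 2 : ℝ)) (q.out • τ) : ℝ) =
      (ModularGroup.fd.indicator (fun τ ↦ petersson 2 f g (q.out⁻¹ • τ) * (1 / 2 : ℂ)))
        (mapGL ℝ q.out • τ) := by
    intro q τ
    change _ = ModularGroup.fd.indicator _ (q.out • τ)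
    by_cases h : q.out • τ ∈ ModularGroup.fd
    · rw [Set.indicator_of_mem h, Set.indicator_of_mem h, inv_smul_smul]
      norm_num
    · rw [Set.indicator_of_notMem h, Set.indicator_of_notMem h]
      simp
  have h2 : ∀ q : SL(2, ℤ) ⧸ Gamma0 N, Integrable (ModularGroup.fd.indicator
      (fun τ ↦ petersson 2 f g (q.out⁻¹ • τ) * (1 / 2 : ℂ))) := fun q ↦
    (integrable_indicator_iff measurableSet_fd).mpr ((integrableOn_petersson f g _).mul_const _)
  have h3 : ∀ τ, petersson 2 f g τ * fdWeight N τ = ∑ q : SL(2, ℤ) ⧸ Gamma0 N,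
      (ModularGroup.fd.indicator (fun τ ↦ petersson 2 f g (q.out⁻¹ • τ) * (1 / 2 : ℂ)))
        (mapGL ℝ q.out • τ) := by
    intro τ
    rw [fdWeight_eq_sum, Complex.ofReal_sum, Finset.mul_sum]
    exact Finset.sum_congr rfl fun q _ ↦ h1 q τ
  simp only [h3]
  rw [integral_finsetSum _ fun q _ ↦ ?_, peterssonInner, finsum_eq_sum_of_fintype, Finset.mul_sum]
  · refine Finset.sum_congr rfl fun q _ ↦ ?_
    rw [integral_smul_eq_self (μ := (volume : Measure ℍ)) (g := mapGL ℝ q.out),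
      integral_indicator measurableSet_fd, integral_mul_const]
    ring
  · have h4 := (measurePreserving_smul (mapGL ℝ q.out) (volume : Measure ℍ))
    have h5 := h4.integrable_comp_of_integrable (h2 q)
    exact h5

end

lemma petersson_slash_of_det_pos (f g : ℍ → ℂ) {α : GL (Fin 2) ℝ} (hα : 0 < α.det.val) (τ : ℍ) :
    petersson 2 (f ∣[(2 : ℤ)] α) (g ∣[(2 : ℤ)] α) τ = petersson 2 f g (α • τ) := by
  rw [petersson_slash, σ, if_pos hα]
  simp

/-- A holomorphic function `f` on `ℍ` such that `|f τ| * im τ` is bounded, with no condition of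
invariance. -/
structure IsBoundedForm (f : ℍ → ℂ) : Prop where
  mdiff : MDiff f
  bounded : ∃ C, ∀ τ, ‖petersson 2 f f τ‖ ≤ C

lemma IsBoundedForm.slash {f : ℍ → ℂ} (hf : IsBoundedForm f) {α : GL (Fin 2) ℝ}
    (hα : 0 < α.det.val) : IsBoundedForm (f ∣[(2 : ℤ)] α) where
  mdiff := hf.mdiff.slash 2 α
  bounded := by
    obtain ⟨C, hC⟩ := hf.bounded
    exact ⟨C, fun τ ↦ by rw [petersson_slash_of_det_pos f f hα]; exact hC _⟩

lemma isBoundedForm_coe {N : ℕ} [NeZero N] (f : S2 N) : IsBoundedForm f where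
  mdiff := f.holo'
  bounded := CuspFormClass.petersson_bounded_left 2 (Gamma0 N : Subgroup (GL (Fin 2) ℝ)) f f

lemma IsBoundedForm.exists_petersson_le {f g : ℍ → ℂ} (hf : IsBoundedForm f)
    (hg : IsBoundedForm g) : ∃ C, ∀ τ, ‖petersson 2 f g τ‖ ≤ C := by
  obtain ⟨C, hC⟩ := hf.bounded
  obtain ⟨D, hD⟩ := hg.bounded
  refine ⟨C + D, fun τ ↦ ?_⟩
  have h1 := hC τ
  have h2 := hD τ
  simp only [petersson, norm_mul, Complex.norm_conj] at h1 h2 ⊢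
  nlinarith [mul_nonneg (sq_nonneg (‖f τ‖ - ‖g τ‖)) (norm_nonneg ((τ.im : ℂ) ^ (2 : ℤ))),
    mul_nonneg (mul_nonneg (norm_nonneg (f τ)) (norm_nonneg (g τ)))
      (norm_nonneg ((τ.im : ℂ) ^ (2 : ℤ)))]

lemma IsBoundedForm.continuous_petersson {f g : ℍ → ℂ} (hf : IsBoundedForm f)
    (hg : IsBoundedForm g) : Continuous (petersson 2 f g) :=
  petersson_continuous 2 hf.mdiff.continuous hg.mdiff.continuous

lemma toGLR_det {M : Matrix (Fin 2) (Fin 2) ℤ} (h : M.det ≠ 0) :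
    (toGLR M).det.val = M.det := by
  rw [Matrix.GeneralLinearGroup.val_det_apply, coe_toGLR h]
  simp [Matrix.det_fin_two]

lemma toGLR_det_pos {M : Matrix (Fin 2) (Fin 2) ℤ} (h : 0 < M.det) : 0 < (toGLR M).det.val := by
  rw [toGLR_det h.ne']
  exact_mod_cast h

section
variable {N : ℕ} [NeZero N]

lemma IsBoundedForm.integrable {f g : ℍ → ℂ} (hf : IsBoundedForm f) (hg : IsBoundedForm g) :
    Integrable fun τ ↦ petersson 2 f g τ * fdWeight N τ := by
  obtain ⟨C, hC⟩ := hf.exists_petersson_le hg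
  exact integrable_mul_fdWeight (hf.continuous_petersson hg).aestronglyMeasurable hC

/-- An integral against `fdWeight N` is unfolded along a translate of the partition of unity given
by `fdWeight N`. -/
lemma hasSum_integral_fdWeight {F : ℍ → ℂ} (hF : Integrable fun τ ↦ F τ * fdWeight N τ)
    (α : GL (Fin 2) ℝ) :
    HasSum (fun γ : Gamma0 N ↦ ∫ τ, F τ * fdWeight N τ * fdWeight N (mapGL ℝ γ.1 • α • τ))
      (∫ τ, F τ * fdWeight N τ) := by
  obtain ⟨C, hC⟩ := exists_fdWeight_le (N := N)
  have hae : ∀ᵐ τ : ℍ, HasSum (fun γ : Gamma0 N ↦ fdWeight N (mapGL ℝ γ.1 • α • τ)) 1 := by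
    have h1 := (measurePreserving_smul α (volume : Measure ℍ)).quasiMeasurePreserving
    have h2 := h1.tendsto_ae.eventually (ae_hasSum_fdWeight (N := N))
    exact h2
  have hint : ∀ γ : Gamma0 N, Integrable
      fun τ ↦ F τ * fdWeight N τ * fdWeight N (mapGL ℝ γ.1 • α • τ) := by
    intro γ
    refine hF.mul_bdd (c := C) ?_ (.of_forall fun τ ↦ ?_)
    · have h1 : Measurable fun τ : ℍ ↦ mapGL ℝ γ.1 • α • τ :=
        (measurable_const_smul (mapGL ℝ γ.1)).comp (measurable_const_smul α)
      exact (Complex.measurable_ofReal.comp (measurable_fdWeight.comp h1)).aestronglyMeasurable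
    · rw [Complex.norm_real, Real.norm_of_nonneg (fdWeight_nonneg _ _)]
      exact hC _
  have h := hasSum_integral_of_summable_integral_norm hint ?_
  · have h1 : ∫ τ, ∑' γ : Gamma0 N, F τ * fdWeight N τ * fdWeight N (mapGL ℝ γ.1 • α • τ) =
        ∫ τ, F τ * fdWeight N τ := by
      refine integral_congr_ae ?_
      filter_upwards [hae] with τ hτ
      rw [tsum_mul_left, ← Complex.ofReal_tsum, hτ.tsum_eq]
      simp
    rw [h1] at h
    exact h
  · refine summable_of_sum_le (c := ∫ τ, ‖F τ * fdWeight N τ‖)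
      (fun γ ↦ integral_nonneg fun τ ↦ norm_nonneg _) fun s ↦ ?_
    have h1 := integral_finsetSum s fun γ _ ↦ (hint γ).norm
    refine h1.symm.trans_le ?_
    refine integral_mono_ae (integrable_finsetSum _ fun γ _ ↦ (hint γ).norm) hF.norm ?_
    filter_upwards [hae] with τ hτ
    simp only [norm_mul (F τ * fdWeight N τ), ← Finset.mul_sum]
    refine mul_le_of_le_one_right (norm_nonneg _) ?_
    simp only [Complex.norm_real, Real.norm_of_nonneg (fdWeight_nonneg _ _)]
    exact sum_le_hasSum s (fun γ _ ↦ fdWeight_nonneg _ _) hτ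

/-- The Petersson inner product is definite. The vanishing of `|f|²` against the weight is spread
by `Γ₀(N)` to almost all of `ℍ`. -/
lemma eq_zero_of_peterssonInner_self {f : S2 N} (h : peterssonInner f f = 0) : f = 0 := by
  rw [peterssonInner_eq_integral, mul_eq_zero, or_iff_right two_ne_zero] at h
  have hb := isBoundedForm_coe f
  have hpos : ∀ τ, petersson 2 f f τ = ((‖f τ‖ ^ 2 * τ.im ^ 2 : ℝ) : ℂ) := by
    intro τ
    rw [petersson, ← Complex.normSq_eq_conj_mul_self, Complex.normSq_eq_norm_sq]
    push_cast
    norm_cast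
  have h1 : (fun τ ↦ ‖f τ‖ ^ 2 * τ.im ^ 2 * fdWeight N τ) =ᵐ[volume] 0 := by
    rw [← integral_eq_zero_iff_of_nonneg]
    · simp only [hpos] at h
      exact_mod_cast h
    · exact fun τ ↦ mul_nonneg (by positivity) (fdWeight_nonneg _ _)
    · have := (hb.integrable (N := N) hb).re
      refine this.congr (.of_forall fun τ ↦ ?_)
      dsimp only
      rw [hpos, ← Complex.ofReal_mul]
      exact Complex.ofReal_re _
  have h2 : ∀ᵐ τ : ℍ, ∀ γ : Gamma0 N,
      ‖f (mapGL ℝ γ.1 • τ)‖ ^ 2 * (mapGL ℝ γ.1 • τ).im ^ 2 * fdWeight N (mapGL ℝ γ.1 • τ) = 0 := by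
    rw [ae_all_iff]
    intro γ
    exact (measurePreserving_smul (mapGL ℝ γ.1)
      (volume : Measure ℍ)).quasiMeasurePreserving.tendsto_ae.eventually h1
  have h3 : (fun τ ↦ petersson 2 f f τ) =ᵐ[volume] fun _ ↦ 0 := by
    filter_upwards [h2, ae_hasSum_fdWeight (N := N)] with τ h2 hτ
    have h4 : ∃ γ : Gamma0 N, fdWeight N (γ.1 • τ) ≠ 0 := by
      by_contra! h4
      simp only [h4] at hτ
      exact zero_ne_one (hasSum_zero.unique hτ)
    obtain ⟨γ, hγ⟩ := h4
    have h5 := (mul_eq_zero.mp (h2 γ)).resolve_right hγ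
    have h6 : petersson 2 f f (mapGL ℝ γ.1 • τ) = petersson 2 f f τ :=
      SlashInvariantFormClass.petersson_smul (Γ := (Gamma0 N : Subgroup (GL (Fin 2) ℝ)))
        ⟨γ.1, γ.2, rfl⟩
    rw [← h6, hpos, h5, Complex.ofReal_zero]
  have h4 := Measure.eq_of_ae_eq h3 (hb.continuous_petersson hb) continuous_const
  ext τ
  have h5 := congr_fun h4 τ
  rw [hpos] at h5
  have h6 : ‖f τ‖ ^ 2 * τ.im ^ 2 = 0 := by exact_mod_cast h5
  simpa [τ.im_ne_zero] using h6

lemma peterssonInner_conj_symm (f g : S2 N) :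
    peterssonInner g f = starRingEnd ℂ (peterssonInner f g) := by
  rw [peterssonInner_eq_integral, peterssonInner_eq_integral, map_mul, ← integral_conj]
  congr 1
  · exact (Complex.conj_ofNat 2).symm
  · simp [petersson_symm 2 f g]

end

end

/-! ### Adjoints of operators given by sets of matrices -/

section

open MeasureTheory Matrix.SpecialLinearGroup

/-- The unnormalised Petersson product of level `Γ₀(N)`, for functions that need not be
invariant. -/
noncomputable def weightedInner (N : ℕ) (f g : ℍ → ℂ) : ℂ :=
  ∫ τ, petersson 2 f g τ * fdWeight N τ

/-- The contribution of a single matrix `M` to the unfolding of `⟨f, T g⟩`. -/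
noncomputable def unfoldingTerm (N : ℕ) (f g : ℍ → ℂ) (M : Matrix (Fin 2) (Fin 2) ℤ) : ℂ :=
  ∫ τ, petersson 2 f (g ∣[(2 : ℤ)] toGLR M) τ * fdWeight N τ * fdWeight N (toGLR M • τ)

/-- `X` is a set of representatives of the left cosets of `Γ₀(N)` in the set `S` of integral
matrices of determinant `n`. -/
structure IsLeftReps (N n : ℕ) (X : Finset (Matrix (Fin 2) (Fin 2) ℤ))
    (S : Set (Matrix (Fin 2) (Fin 2) ℤ)) : Prop where
  det_eq : ∀ M ∈ S, M.det = n
  mem_iff : ∀ M, M ∈ S ↔ ∃ γ ∈ Gamma0 N, ∃ x ∈ X, M = γ.1 * x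
  eq_of_eq_mul : ∀ x ∈ X, ∀ y ∈ X, ∀ γ ∈ Gamma0 N, x = γ.1 * y → x = y

lemma IsLeftReps.subset {N n : ℕ} {X : Finset (Matrix (Fin 2) (Fin 2) ℤ)}
    {S : Set (Matrix (Fin 2) (Fin 2) ℤ)} (h : IsLeftReps N n X S) {x : Matrix (Fin 2) (Fin 2) ℤ}
    (hx : x ∈ X) : x ∈ S :=
  (h.mem_iff x).mpr ⟨1, one_mem _, x, hx, by simp⟩

lemma adjugate_adjugate_fin_two (M : Matrix (Fin 2) (Fin 2) ℤ) : M.adjugate.adjugate = M := by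
  ext i j
  fin_cases i <;> fin_cases j <;> simp [Matrix.adjugate_fin_two]

lemma det_adjugate_fin_two (M : Matrix (Fin 2) (Fin 2) ℤ) : M.adjugate.det = M.det := by
  simp [Matrix.det_adjugate]

lemma det_scalar_pos {n : ℤ} (hn : n ≠ 0) : 0 < (!![n, 0; 0, n]).det := by
  rw [Matrix.det_fin_two_of]
  nlinarith [sq_pos_of_ne_zero hn]

lemma toGLR_scalar_smul {n : ℤ} (hn : n ≠ 0) (τ : ℍ) : toGLR !![n, 0; 0, n] • τ = τ := by
  have hn' : (n : ℂ) ≠ 0 := by exact_mod_cast hn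
  have hpos := det_scalar_pos hn
  ext
  rw [coe_smul_of_det_pos (toGLR_det_pos hpos), num, denom, coe_toGLR hpos.ne']
  simp [hn']

lemma slash_toGLR_scalar (f : ℍ → ℂ) {n : ℤ} (hn : n ≠ 0) :
    f ∣[(2 : ℤ)] toGLR !![n, 0; 0, n] = f := by
  have hn' : (n : ℂ) ≠ 0 := by exact_mod_cast hn
  have hpos := det_scalar_pos hn
  ext τ
  rw [slash_apply, toGLR_scalar_smul hn, toGLR_det hpos.ne', Matrix.det_fin_two_of, σ,
    if_pos (toGLR_det_pos hpos), denom, coe_toGLR hpos.ne']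
  simp
  norm_cast
  push_cast
  field_simp

lemma toGLR_adjugate_mul {M : Matrix (Fin 2) (Fin 2) ℤ} (h : M.det ≠ 0) :
    toGLR M.adjugate * toGLR M = toGLR !![M.det, 0; 0, M.det] := by
  rw [← toGLR_mul (by rwa [det_adjugate_fin_two]) h, Matrix.adjugate_mul]
  congr 1
  ext i j
  fin_cases i <;> fin_cases j <;> simp only [Matrix.smul_apply] <;> simp

lemma slash_toGLR_mul_of_mem {N : ℕ} {g : ℍ → ℂ}
    (hg : ∀ γ ∈ Gamma0 N, g ∣[(2 : ℤ)] (mapGL ℝ γ : GL (Fin 2) ℝ) = g) {γ : SL(2, ℤ)}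
    (hγ : γ ∈ Gamma0 N) {x : Matrix (Fin 2) (Fin 2) ℤ} (hx : x.det ≠ 0) :
    g ∣[(2 : ℤ)] toGLR (γ.1 * x) = g ∣[(2 : ℤ)] toGLR x := by
  rw [toGLR_mul (by simp) hx, SlashAction.slash_mul, toGLR_SL, hg γ hγ]

lemma slash_mapGL_coe {N : ℕ} (f : S2 N) :
    ∀ γ ∈ Gamma0 N, (f : ℍ → ℂ) ∣[(2 : ℤ)] (mapGL ℝ γ : GL (Fin 2) ℝ) = f :=
  fun γ hγ ↦ f.slash_action_eq' _ ⟨γ, hγ, rfl⟩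

/-- Substituting `M τ` for `τ` exchanges the roles of `f` and `g`. -/
lemma unfoldingTerm_adjugate (N : ℕ) (f g : ℍ → ℂ) {M : Matrix (Fin 2) (Fin 2) ℤ}
    (hM : 0 < M.det) :
    unfoldingTerm N g f M.adjugate = starRingEnd ℂ (unfoldingTerm N f g M) := by
  rw [unfoldingTerm, ← integral_smul_eq_self (μ := (volume : Measure ℍ)) (g := toGLR M),
    unfoldingTerm, ← integral_conj]
  congr 1
  funext τ
  rw [← petersson_slash_of_det_pos _ _ (toGLR_det_pos hM), ← SlashAction.slash_mul, smul_smul,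
    toGLR_adjugate_mul hM.ne', slash_toGLR_scalar f hM.ne', toGLR_scalar_smul hM.ne',
    petersson_symm 2 f]
  simp only [map_mul, Complex.conj_ofReal]
  ring

variable {N : ℕ} [NeZero N]

lemma peterssonInner_eq_weightedInner (f g : S2 N) :
    peterssonInner f g = 2 * weightedInner N f g :=
  peterssonInner_eq_integral f g

lemma IsLeftReps.hasSum_unfoldingTerm {n : ℕ} (hn : 0 < n)
    {X : Finset (Matrix (Fin 2) (Fin 2) ℤ)} {S : Set (Matrix (Fin 2) (Fin 2) ℤ)}
    (hX : IsLeftReps N n X S) {f g : ℍ → ℂ} (hf : IsBoundedForm f) (hg : IsBoundedForm g)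
    (hgi : ∀ γ ∈ Gamma0 N, g ∣[(2 : ℤ)] (mapGL ℝ γ : GL (Fin 2) ℝ) = g) :
    HasSum (fun M : S ↦ unfoldingTerm N f g M)
      (∑ x ∈ X, weightedInner N f (g ∣[(2 : ℤ)] toGLR x)) := by
  have hn' : (n : ℤ) ≠ 0 := by exact_mod_cast hn.ne'
  have hinj : ∀ x ∈ X, Function.Injective fun γ : Gamma0 N ↦ γ.1.1 * x := by
    intro x hx γ δ h
    refine Subtype.ext (Subtype.ext ?_)
    have h1 := congrArg (· * x.adjugate) h
    simp only [mul_assoc, Matrix.mul_adjugate, hX.det_eq x (hX.subset hx)] at h1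
    ext i j
    have h2 := congr_fun₂ h1 i j
    simp only [Matrix.mul_smul, mul_one, Matrix.smul_apply, smul_eq_mul] at h2
    exact mul_left_cancel₀ hn' h2
  have hS : S = ⋃ x ∈ X, Set.range fun γ : Gamma0 N ↦ γ.1.1 * x := by
    ext M
    rw [hX.mem_iff]
    simp only [Set.mem_iUnion, Set.mem_range, Subtype.exists, exists_prop]
    constructor
    · rintro ⟨γ, hγ, x, hx, rfl⟩
      exact ⟨x, hx, γ, hγ, rfl⟩
    · rintro ⟨x, hx, γ, hγ, rfl⟩
      exact ⟨γ, hγ, x, hx, rfl⟩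
  rw [hS]
  refine hasSum_sum_disjoint (f := unfoldingTerm N f g) X ?_ fun x hx ↦ ?_
  · intro x hx y hy hxy
    rw [Function.onFun, Set.disjoint_left]
    rintro _ ⟨γ, rfl⟩ ⟨δ, hδ⟩
    refine hxy (hX.eq_of_eq_mul x hx y hy (γ.1⁻¹ * δ.1) (mul_mem (inv_mem γ.2) δ.2) ?_)
    dsimp only at hδ
    rw [Matrix.SpecialLinearGroup.coe_mul, mul_assoc, hδ, ← mul_assoc,
      ← Matrix.SpecialLinearGroup.coe_mul]
    simp
  · have hdet : 0 < x.det := by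
      rw [hX.det_eq x (hX.subset hx)]
      exact_mod_cast hn
    rw [Function.comp_def, (hinj x hx).hasSum_range_iff (f := unfoldingTerm N f g)]
    have h1 := hasSum_integral_fdWeight (hf.integrable (N := N) (hg.slash (toGLR_det_pos hdet)))
      (toGLR x)
    refine h1.congr_fun fun γ ↦ ?_
    simp only [Function.comp, unfoldingTerm]
    rw [slash_toGLR_mul_of_mem hgi γ.2 hdet.ne', toGLR_mul (by simp) hdet.ne', toGLR_SL]
    simp only [mul_smul]

/-- The adjoint, for the Petersson product, of the operator given by a set `S` of matrices is the
operator given by the set of the adjugates. Both sides unfold to sums over the elements of the two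
sets, which agree term by term. -/
lemma IsLeftReps.sum_weightedInner_adjugate {n : ℕ} (hn : 0 < n)
    {X Y : Finset (Matrix (Fin 2) (Fin 2) ℤ)} {S : Set (Matrix (Fin 2) (Fin 2) ℤ)}
    (hX : IsLeftReps N n X S) (hY : IsLeftReps N n Y (Matrix.adjugate ⁻¹' S)) {f g : ℍ → ℂ}
    (hf : IsBoundedForm f) (hg : IsBoundedForm g)
    (hfi : ∀ γ ∈ Gamma0 N, f ∣[(2 : ℤ)] (mapGL ℝ γ : GL (Fin 2) ℝ) = f)
    (hgi : ∀ γ ∈ Gamma0 N, g ∣[(2 : ℤ)] (mapGL ℝ γ : GL (Fin 2) ℝ) = g) :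
    ∑ x ∈ X, weightedInner N f (g ∣[(2 : ℤ)] toGLR x) =
      starRingEnd ℂ (∑ y ∈ Y, weightedInner N g (f ∣[(2 : ℤ)] toGLR y)) := by
  have h1 := hX.hasSum_unfoldingTerm hn hf hg hgi
  have h2 := Complex.hasSum_conj'.mpr (hY.hasSum_unfoldingTerm hn hg hf hfi)
  let e : S ≃ (Matrix.adjugate ⁻¹' S : Set (Matrix (Fin 2) (Fin 2) ℤ)) :=
    { toFun M := ⟨M.1.adjugate, by simp [adjugate_adjugate_fin_two]⟩
      invFun M := ⟨M.1.adjugate, M.2⟩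
      left_inv M := Subtype.ext (adjugate_adjugate_fin_two _)
      right_inv M := Subtype.ext (adjugate_adjugate_fin_two _) }
  rw [← e.hasSum_iff] at h2
  refine h1.unique (h2.congr_fun fun M ↦ ?_)
  have hdet : 0 < M.1.det := by
    rw [hX.det_eq _ M.2]
    exact_mod_cast hn
  change _ = starRingEnd ℂ (unfoldingTerm N g f M.1.adjugate)
  rw [unfoldingTerm_adjugate N f g hdet, Complex.conj_conj]

lemma weightedInner_sum_right {X : Finset (Matrix (Fin 2) (Fin 2) ℤ)} {f g : ℍ → ℂ}
    (hf : IsBoundedForm f) (hg : IsBoundedForm g) (hX : ∀ x ∈ X, 0 < x.det) :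
    weightedInner N f (∑ x ∈ X, g ∣[(2 : ℤ)] toGLR x) =
      ∑ x ∈ X, weightedInner N f (g ∣[(2 : ℤ)] toGLR x) := by
  simp only [weightedInner]
  rw [← integral_finsetSum _ fun x hx ↦ hf.integrable (hg.slash (toGLR_det_pos (hX x hx)))]
  congr 1
  funext τ
  simp only [petersson, Finset.sum_apply, Finset.mul_sum, Finset.sum_mul]

end

/-! ### Operators between spaces of cusp forms given by sets of matrices -/

section

open MeasureTheory Matrix.SpecialLinearGroup

section

variable {A B n : ℕ} {X : Finset (Matrix (Fin 2) (Fin 2) ℤ)} {S : Set (Matrix (Fin 2) (Fin 2) ℤ)}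

lemma IsLeftReps.det_pos (hn : 0 < n) (hX : IsLeftReps A n X S) {x : Matrix (Fin 2) (Fin 2) ℤ}
    (hx : x ∈ X) : 0 < x.det := by
  rw [hX.det_eq x (hX.subset hx)]
  exact_mod_cast hn

lemma IsLeftReps.sum_slash_mapGL (hn : 0 < n) (hX : IsLeftReps A n X S)
    (hS : ∀ M ∈ S, ∀ γ ∈ Gamma0 B, M * γ.1 ∈ S) (g : S2 A) {γ : SL(2, ℤ)} (hγ : γ ∈ Gamma0 B) :
    (∑ x ∈ X, (g : ℍ → ℂ) ∣[(2 : ℤ)] toGLR x) ∣[(2 : ℤ)] (mapGL ℝ γ : GL (Fin 2) ℝ) =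
      ∑ x ∈ X, (g : ℍ → ℂ) ∣[(2 : ℤ)] toGLR x := by
  have key : ∀ x ∈ X, ∃ y ∈ X, ∃ δ ∈ Gamma0 A, x * γ.1 = δ.1 * y := by
    intro x hx
    obtain ⟨δ, hδ, y, hy, h⟩ := (hX.mem_iff _).mp (hS x (hX.subset hx) γ hγ)
    exact ⟨y, hy, δ, hδ, h⟩
  choose! φ hφ δ hδ hφe using key
  have hinj : Set.InjOn φ X := by
    intro x hx y hy hxy
    refine hX.eq_of_eq_mul x hx y hy (δ x * (δ y)⁻¹) (mul_mem (hδ x hx) (inv_mem (hδ y hy))) ?_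
    have h1 : x * γ.1 * (γ⁻¹ : SL(2, ℤ)).1 = (δ x).1 * φ x * (γ⁻¹ : SL(2, ℤ)).1 := by
      rw [hφe x hx]
    have h2 : φ y * (γ⁻¹ : SL(2, ℤ)).1 = ((δ y)⁻¹ : SL(2, ℤ)).1 * y := by
      have h3 : ((δ y)⁻¹ : SL(2, ℤ)).1 * (y * γ.1) * (γ⁻¹ : SL(2, ℤ)).1 =
          ((δ y)⁻¹ : SL(2, ℤ)).1 * ((δ y).1 * φ y) * (γ⁻¹ : SL(2, ℤ)).1 := by rw [hφe y hy]
      rw [← mul_assoc _ (δ y).1, ← Matrix.SpecialLinearGroup.coe_mul, inv_mul_cancel, mul_assoc,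
        mul_assoc y, ← Matrix.SpecialLinearGroup.coe_mul, mul_inv_cancel] at h3
      simpa using h3.symm
    rw [mul_assoc, ← Matrix.SpecialLinearGroup.coe_mul, mul_inv_cancel, hxy, mul_assoc, h2] at h1
    rw [Matrix.SpecialLinearGroup.coe_mul, mul_assoc, ← h1]
    simp
  rw [SlashAction.sum_slash]
  refine Finset.sum_nbij φ hφ hinj (Finset.surjOn_of_injOn_of_card_le φ hφ hinj le_rfl) ?_
  intro x hx
  rw [← SlashAction.slash_mul, ← toGLR_SL, ← toGLR_mul (hX.det_pos hn hx).ne' (by simp),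
    hφe x hx, slash_toGLR_mul_of_mem (slash_mapGL_coe g) (hδ x hx) (hX.det_pos hn (hφ x hx)).ne']

lemma isZeroAt_sum_slash [NeZero A] [NeZero B] (X : Finset (Matrix (Fin 2) (Fin 2) ℤ)) (g : S2 A)
    {c : OnePoint ℝ} (hc : IsCusp c (Gamma0 B : Subgroup (GL (Fin 2) ℝ))) :
    c.IsZeroAt (∑ x ∈ X, (g : ℍ → ℂ) ∣[(2 : ℤ)] toGLR x) 2 := by
  refine Finset.sum_induction _ (fun F ↦ c.IsZeroAt F 2) (fun _ _ h h' ↦ h.add h') ?_ ?_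
  · intro g _
    rw [SlashAction.zero_slash]
    exact Filter.zero_zeroAtFilter _
  · intro x _
    rw [← OnePoint.IsZeroAt.smul_iff]
    apply g.zero_at_cusps'
    rw [Subgroup.IsArithmetic.isCusp_iff_isCusp_SL2Z, isCusp_SL2Z_iff] at hc ⊢
    obtain ⟨c', rfl⟩ := hc
    refine ⟨toGLQ x • c', ?_⟩
    rw [← Rat.coe_castHom, OnePoint.map_smul]
    rfl

/-- A set of matrices that is stable under `Γ₀(A)` on the left and under `Γ₀(B)` on the right
defines a map `S₂(Γ₀(A)) → S₂(Γ₀(B))`. -/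
lemma IsLeftReps.exists_cuspForm [NeZero A] [NeZero B] (hn : 0 < n) (hX : IsLeftReps A n X S)
    (hS : ∀ M ∈ S, ∀ γ ∈ Gamma0 B, M * γ.1 ∈ S) (g : S2 A) :
    ∃ h : S2 B, (h : ℍ → ℂ) = ∑ x ∈ X, (g : ℍ → ℂ) ∣[(2 : ℤ)] toGLR x := by
  refine ⟨
    { toFun := ∑ x ∈ X, (g : ℍ → ℂ) ∣[(2 : ℤ)] toGLR x
      slash_action_eq' := ?_
      holo' := ?_
      zero_at_cusps' := isZeroAt_sum_slash X g }, rfl⟩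
  · rintro _ ⟨γ, hγ, rfl⟩
    exact hX.sum_slash_mapGL hn hS g hγ
  · exact Finset.sum_induction _ (fun F : ℍ → ℂ ↦ MDiff F) (fun _ _ h h' ↦ h.add h')
      mdifferentiable_const fun x _ ↦ g.holo'.slash 2 _

end

/-! ### Sets of integral matrices of determinant `n` -/

/-- The integral matrices of determinant `n` that define the Hecke operator `Tₙ`. -/
def heckeSet (N n : ℕ) : Set (Matrix (Fin 2) (Fin 2) ℤ) :=
  {M | M.det = n ∧ (N : ℤ) ∣ M 1 0 ∧ IsCoprime (M 0 0) (N : ℤ)}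

/-- The set `(1 0; 0 p) Γ₀(M)`, for `N = p M`. It defines the trace to level `Γ₀(M)` of
`g(τ / p)`. -/
def traceSet (N p : ℕ) : Set (Matrix (Fin 2) (Fin 2) ℤ) :=
  {M | M.det = p ∧ (N : ℤ) ∣ M 1 0 ∧ (p : ℤ) ∣ M 1 1}

/-- The matrices of the Atkin-Lehner involution at a prime `p` that divides `N` exactly once. -/
def atkinLehnerSet (N p : ℕ) : Set (Matrix (Fin 2) (Fin 2) ℤ) :=
  {M | M.det = p ∧ (N : ℤ) ∣ M 1 0 ∧ (p : ℤ) ∣ M 0 0 ∧ (p : ℤ) ∣ M 1 1}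

lemma dvd_apply_of_mem_Gamma0 {N : ℕ} {γ : SL(2, ℤ)} (hγ : γ ∈ Gamma0 N) : (N : ℤ) ∣ γ 1 0 :=
  (ZMod.intCast_zmod_eq_zero_iff_dvd _ N).mp (Gamma0_mem.mp hγ)

lemma mem_Gamma0_of_dvd {N : ℕ} {γ : SL(2, ℤ)} (h : (N : ℤ) ∣ γ 1 0) : γ ∈ Gamma0 N :=
  Gamma0_mem.mpr ((ZMod.intCast_zmod_eq_zero_iff_dvd _ N).mpr h)

lemma SL_det_eq (γ : SL(2, ℤ)) : γ 0 0 * γ 1 1 - γ 0 1 * γ 1 0 = 1 := by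
  have := γ.det_coe; rwa [Matrix.det_fin_two] at this

lemma isCoprime_apply_of_mem_Gamma0 {N : ℕ} {γ : SL(2, ℤ)} (hγ : γ ∈ Gamma0 N) :
    IsCoprime (γ 0 0) (N : ℤ) := by
  obtain ⟨c, hc⟩ := dvd_apply_of_mem_Gamma0 hγ
  have := SL_det_eq γ
  exact ⟨γ 1 1, -(γ 0 1 * c), by rw [hc] at this; linear_combination this⟩

lemma repMat_injective : Function.Injective repMat := by
  rintro ⟨⟨a, d⟩, b⟩ ⟨⟨a', d'⟩, b'⟩ h
  have h0 := congr_fun₂ h 0 0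
  have h1 := congr_fun₂ h 0 1
  have h2 := congr_fun₂ h 1 1
  simp [repMat] at h0 h1 h2
  simp [h0, h1, h2]

lemma isLeftReps_heckeSet (N : ℕ) {n : ℕ} (hn : 0 < n) :
    IsLeftReps N n ((reps N n).image repMat) (heckeSet N n) where
  det_eq M hM := hM.1
  mem_iff M := by
    constructor
    · rintro ⟨h1, h2, h3⟩
      obtain ⟨γ, hγ, a, b, d, had, ha, hbd, h⟩ := exists_decomp hn h1 h2 h3
      exact ⟨γ, hγ, _, Finset.mem_image_of_mem _
        (mem_reps.mpr ⟨⟨⟨had, hn.ne'⟩, ha⟩, hbd⟩ : (⟨(a, d), b⟩ : Σ _ : ℕ × ℕ, ℕ) ∈ _), h⟩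
    · rintro ⟨γ, hγ, x, hx, rfl⟩
      obtain ⟨x, hx', rfl⟩ := Finset.mem_image.mp hx
      refine ⟨by simp [det_repMat hx'], ?_, ?_⟩
      · simpa [repMat, Matrix.mul_apply, Fin.sum_univ_two] using
          (dvd_apply_of_mem_Gamma0 hγ).mul_right _
      · have h1 := isCoprime_apply_of_mem_Gamma0 hγ
        have h2 : IsCoprime (x.1.1 : ℤ) N := Nat.isCoprime_iff_coprime.mpr (mem_reps.mp hx').1.2
        simpa [repMat, Matrix.mul_apply, Fin.sum_univ_two] using h1.mul_left h2
  eq_of_eq_mul := by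
    intro x hx y hy γ hγ h
    obtain ⟨⟨⟨a, d⟩, b⟩, hx', rfl⟩ := Finset.mem_image.mp hx
    obtain ⟨⟨⟨a', d'⟩, b'⟩, hy', rfl⟩ := Finset.mem_image.mp hy
    obtain ⟨⟨⟨hx1, -⟩, -⟩, hx2⟩ := mem_reps.mp hx'
    obtain ⟨⟨⟨hy1, -⟩, -⟩, hy2⟩ := mem_reps.mp hy'
    dsimp only at hx1 hx2 hy1 hy2
    have ha : 0 < a := Nat.pos_of_ne_zero fun h ↦ hn.ne' (by rw [← hx1, h, zero_mul])
    have ha' : 0 < a' := Nat.pos_of_ne_zero fun h ↦ hn.ne' (by rw [← hy1, h, zero_mul])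
    obtain ⟨rfl, rfl, rfl⟩ := upper_unique ha ha' hx2 hy2 h
    rfl

lemma coe_heckeT {N : ℕ} [NeZero N] (n : ℕ) (g : S2 N) : (heckeT N n g : ℍ → ℂ) =
    ∑ x ∈ (reps N n).image repMat, (g : ℍ → ℂ) ∣[(2 : ℤ)] toGLR x := by
  rw [Finset.sum_image repMat_injective.injOn]
  exact heckeFun_eq N n g

lemma isLeftReps_union {N n : ℕ} {X Y : Finset (Matrix (Fin 2) (Fin 2) ℤ)}
    {S T : Set (Matrix (Fin 2) (Fin 2) ℤ)} (hX : IsLeftReps N n X S) (hY : IsLeftReps N n Y T)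
    (hST : Disjoint S T) : IsLeftReps N n (X ∪ Y) (S ∪ T) where
  det_eq M hM := hM.elim (hX.det_eq M) (hY.det_eq M)
  mem_iff M := by
    rw [Set.mem_union, hX.mem_iff, hY.mem_iff]
    simp only [Finset.mem_union]
    grind
  eq_of_eq_mul x hx y hy γ hγ h := by
    rcases Finset.mem_union.mp hx with hx | hx <;> rcases Finset.mem_union.mp hy with hy | hy
    · exact hX.eq_of_eq_mul x hx y hy γ hγ h
    · exact (Set.disjoint_left.mp hST (hX.subset hx) ((hY.mem_iff x).mpr ⟨γ, hγ, y, hy, h⟩)).elim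
    · exact (Set.disjoint_left.mp hST ((hX.mem_iff x).mpr ⟨γ, hγ, y, hy, h⟩) (hY.subset hx)).elim
    · exact hY.eq_of_eq_mul x hx y hy γ hγ h

lemma heckeSet_adjugate {N n : ℕ} (h : n.Coprime N) :
    Matrix.adjugate ⁻¹' heckeSet N n = heckeSet N n := by
  have key : ∀ M, M ∈ heckeSet N n → M.adjugate ∈ heckeSet N n := by
    rintro M ⟨h1, ⟨c, h2⟩, h3⟩
    refine ⟨by rw [det_adjugate_fin_two, h1], ?_, ?_⟩
    · simpa [Matrix.adjugate_fin_two] using ⟨c, h2⟩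
    · have h4 : IsCoprime (n : ℤ) N := Nat.isCoprime_iff_coprime.mpr h
      rw [Matrix.det_fin_two] at h1
      have h5 : IsCoprime (M 0 0 * M 1 1) (N : ℤ) := by
        rw [show M 0 0 * M 1 1 = n + N * (M 0 1 * c) by rw [h2] at h1; linear_combination h1]
        exact h4.add_mul_left_left _
      simpa [Matrix.adjugate_fin_two] using h5.of_mul_left_right
  ext M
  refine ⟨fun h ↦ ?_, key M⟩
  simpa [adjugate_adjugate_fin_two] using key _ h

lemma atkinLehnerSet_adjugate (N p : ℕ) :
    Matrix.adjugate ⁻¹' atkinLehnerSet N p = atkinLehnerSet N p := by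
  ext M
  simp [atkinLehnerSet, Matrix.adjugate_fin_two, Matrix.det_fin_two, and_comm, mul_comm]

lemma isLeftReps_adjugate_traceSet {M p : ℕ} (hp : 0 < p) :
    IsLeftReps M p {!![(p : ℤ), 0; 0, 1]} (Matrix.adjugate ⁻¹' traceSet (p * M) p) where
  det_eq x hx := by rw [← det_adjugate_fin_two]; exact hx.1
  mem_iff x := by
    simp only [Finset.mem_singleton, exists_eq_left]
    constructor
    · rintro ⟨h1, h2, h3⟩
      rw [det_adjugate_fin_two, Matrix.det_fin_two] at h1
      obtain ⟨c, hc⟩ : ((p * M : ℕ) : ℤ) ∣ x 1 0 := by simpa [Matrix.adjugate_fin_two] using h2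
      obtain ⟨a, ha⟩ : (p : ℤ) ∣ x 0 0 := by simpa [Matrix.adjugate_fin_two] using h3
      push_cast at hc
      have hp' : (p : ℤ) ≠ 0 := by exact_mod_cast hp.ne'
      refine ⟨⟨!![a, x 0 1; M * c, x 1 1], ?_⟩, mem_Gamma0_of_dvd ⟨c, rfl⟩, ?_⟩
      · rw [Matrix.det_fin_two_of]
        refine mul_left_cancel₀ hp' ?_
        rw [ha, hc] at h1
        linear_combination h1
      · ext i j
        fin_cases i <;> fin_cases j <;> simp [Matrix.mul_apply, Fin.sum_univ_two, ha, hc] <;> ring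
    · rintro ⟨γ, hγ, rfl⟩
      obtain ⟨c, hc⟩ := dvd_apply_of_mem_Gamma0 hγ
      refine ⟨?_, ?_, ?_⟩
      · rw [det_adjugate_fin_two]
        simp
      · simp [Matrix.adjugate_fin_two, Matrix.mul_apply, Fin.sum_univ_two, hc]
        exact ⟨c, by ring⟩
      · simp [Matrix.adjugate_fin_two, Matrix.mul_apply, Fin.sum_univ_two]
  eq_of_eq_mul x hx y hy _ _ _ := by
    rw [Finset.mem_singleton.mp hx, Finset.mem_singleton.mp hy]

lemma exists_isLeftReps_adjugate_traceSet {M p : ℕ} [NeZero (p * M)] (hp : 0 < p) :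
    ∃ Y, IsLeftReps (p * M) p Y (Matrix.adjugate ⁻¹' traceSet (p * M) p) := by
  classical
  have := Fintype.ofFinite (SL(2, ℤ) ⧸ Gamma0 (p * M))
  have hle : ∀ γ ∈ Gamma0 (p * M), γ ∈ Gamma0 M := fun γ hγ ↦ mem_Gamma0_of_dvd
    ((Int.natCast_dvd_natCast.mpr (dvd_mul_left M p)).trans (dvd_apply_of_mem_Gamma0 hγ))
  have hM := isLeftReps_adjugate_traceSet (M := M) hp
  have hβ : (!![(p : ℤ), 0; 0, 1]).det ≠ 0 := by simpa using hp.ne'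
  have hcancel : ∀ γ δ : SL(2, ℤ), γ.1 * !![(p : ℤ), 0; 0, 1] = δ.1 * !![(p : ℤ), 0; 0, 1] →
      γ = δ := by
    intro γ δ h
    have h1 := congrArg toGLR h
    rw [toGLR_mul (by simp) hβ, toGLR_mul (by simp) hβ, mul_left_inj, toGLR_SL, toGLR_SL] at h1
    exact mapGL_injective h1
  refine ⟨{q : SL(2, ℤ) ⧸ Gamma0 (p * M) | q.out⁻¹ ∈ Gamma0 M}.toFinset.image
    fun q ↦ q.out⁻¹.1 * !![(p : ℤ), 0; 0, 1], hM.det_eq, fun x ↦ ?_, ?_⟩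
  · rw [hM.mem_iff]
    simp only [Finset.mem_singleton, exists_eq_left, Finset.mem_image, Set.mem_toFinset]
    constructor
    · rintro ⟨δ, hδ, rfl⟩
      have h1 : ((QuotientGroup.mk δ⁻¹ : SL(2, ℤ) ⧸ Gamma0 (p * M)).out)⁻¹ * δ⁻¹ ∈
          Gamma0 (p * M) := by
        rw [← QuotientGroup.eq]; simp
      refine ⟨_, inv_mem h1, _, ⟨QuotientGroup.mk δ⁻¹, ?_, rfl⟩, ?_⟩
      · have := mul_mem (hle _ h1) hδ
        simpa using this
      · rw [← mul_assoc, ← Matrix.SpecialLinearGroup.coe_mul]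
        simp
    · rintro ⟨γ, hγ, _, ⟨q, hq, rfl⟩, rfl⟩
      exact ⟨γ * q.out⁻¹, mul_mem (hle γ hγ) hq, by
        rw [Matrix.SpecialLinearGroup.coe_mul, mul_assoc]⟩
  · intro x hx y hy γ hγ h
    obtain ⟨q, -, rfl⟩ := Finset.mem_image.mp hx
    obtain ⟨r, -, rfl⟩ := Finset.mem_image.mp hy
    rw [← mul_assoc, ← Matrix.SpecialLinearGroup.coe_mul] at h
    have h1 := hcancel _ _ h
    have h2 : q = r := by
      rw [← q.out_eq', ← r.out_eq']
      refine QuotientGroup.eq.mpr ?_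
      rw [h1, inv_mul_cancel_right]
      exact hγ
    rw [h2]

end

/-! ### Hecke, trace and Atkin-Lehner matrices -/

section

open MeasureTheory Matrix.SpecialLinearGroup

lemma mul_mem_traceSet {M p : ℕ} {x : Matrix (Fin 2) (Fin 2) ℤ} (hx : x ∈ traceSet (p * M) p)
    {γ : SL(2, ℤ)} (hγ : γ ∈ Gamma0 M) : x * γ.1 ∈ traceSet (p * M) p := by
  obtain ⟨h1, ⟨c, hc⟩, d, hd⟩ := hx
  obtain ⟨e, he⟩ := dvd_apply_of_mem_Gamma0 hγ
  push_cast at hc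
  refine ⟨by simp [h1], ?_, ?_⟩
  · simp only [Matrix.mul_apply, Fin.sum_univ_two, hc, hd, he]
    exact ⟨c * γ 0 0 + d * e, by push_cast; ring⟩
  · simp only [Matrix.mul_apply, Fin.sum_univ_two, hc, hd]
    exact ⟨M * c * γ 0 1 + d * γ 1 1, by ring⟩

lemma mul_mem_adjugate_traceSet {M p : ℕ} {x : Matrix (Fin 2) (Fin 2) ℤ}
    (hx : x ∈ Matrix.adjugate ⁻¹' traceSet (p * M) p)
    {γ : SL(2, ℤ)} (hγ : γ ∈ Gamma0 (p * M)) :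
    x * γ.1 ∈ Matrix.adjugate ⁻¹' traceSet (p * M) p := by
  obtain ⟨h1, h2, h3⟩ := hx
  rw [det_adjugate_fin_two] at h1
  obtain ⟨c, hc⟩ : ((p * M : ℕ) : ℤ) ∣ x 1 0 := by simpa [Matrix.adjugate_fin_two] using h2
  obtain ⟨a, ha⟩ : (p : ℤ) ∣ x 0 0 := by simpa [Matrix.adjugate_fin_two] using h3
  obtain ⟨e, he⟩ := dvd_apply_of_mem_Gamma0 hγ
  push_cast at hc he
  refine ⟨by rw [det_adjugate_fin_two]; simp [h1], ?_, ?_⟩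
  · simp [Matrix.adjugate_fin_two, Matrix.mul_apply, Fin.sum_univ_two, hc, he]
    exact ⟨-(c * γ 0 0 + x 1 1 * e), by ring⟩
  · simp [Matrix.adjugate_fin_two, Matrix.mul_apply, Fin.sum_univ_two, ha, he]
    exact ⟨a * γ 0 0 + x 0 1 * (M * e), by ring⟩

lemma isCoprime_of_mem_traceSet {M p : ℕ} (hp : p.Prime) {x : Matrix (Fin 2) (Fin 2) ℤ}
    (hx : x ∈ traceSet (p * M) p) : IsCoprime (x 0 0) (M : ℤ) := by
  obtain ⟨h1, ⟨c, hc⟩, d, hd⟩ := hx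
  have hp' : (p : ℤ) ≠ 0 := by exact_mod_cast hp.ne_zero
  rw [Matrix.det_fin_two, hc, hd] at h1
  push_cast at h1
  exact ⟨d, -(x 0 1 * c), mul_left_cancel₀ hp' (by linear_combination h1)⟩

lemma heckeSet_subset_traceSet (M p : ℕ) : heckeSet (p * M) p ⊆ traceSet (p * M) p := by
  rintro x ⟨h1, ⟨c, hc⟩, h2⟩
  refine ⟨h1, ⟨c, hc⟩, ?_⟩
  rw [Matrix.det_fin_two, hc] at h1
  push_cast at h1 h2
  have h3 : IsCoprime (p : ℤ) (x 0 0) := h2.of_mul_right_left.symm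
  exact h3.dvd_of_dvd_mul_left ⟨1 + x 0 1 * M * c, by linear_combination h1⟩

lemma traceSet_eq_heckeSet {M p : ℕ} (hp : p.Prime) (hpM : p ∣ M) :
    traceSet (p * M) p = heckeSet (p * M) p := by
  refine Set.Subset.antisymm (fun x hx ↦ ⟨hx.1, hx.2.1, ?_⟩) (heckeSet_subset_traceSet M p)
  have h := isCoprime_of_mem_traceSet hp hx
  push_cast
  exact (h.of_isCoprime_of_dvd_right (Int.natCast_dvd_natCast.mpr hpM)).mul_right h

lemma traceSet_eq_union {M p : ℕ} (hp : p.Prime) :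
    traceSet (p * M) p = heckeSet (p * M) p ∪ atkinLehnerSet (p * M) p := by
  refine Set.Subset.antisymm (fun x hx ↦ ?_)
    (Set.union_subset (heckeSet_subset_traceSet M p) fun x hx ↦ ⟨hx.1, hx.2.1, hx.2.2.2⟩)
  by_cases hpx : (p : ℤ) ∣ x 0 0
  · exact Or.inr ⟨hx.1, hx.2.1, hpx, hx.2.2⟩
  · refine Or.inl ⟨hx.1, hx.2.1, ?_⟩
    push_cast
    exact (((Nat.prime_iff_prime_int.mp hp).coprime_iff_not_dvd.mpr hpx).symm).mul_right
      (isCoprime_of_mem_traceSet hp hx)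

lemma disjoint_heckeSet_atkinLehnerSet {M p : ℕ} (hp : p.Prime) :
    Disjoint (heckeSet (p * M) p) (atkinLehnerSet (p * M) p) := by
  rw [Set.disjoint_left]
  rintro x ⟨-, -, h1⟩ ⟨-, -, h2, -⟩
  push_cast at h1
  exact (Nat.prime_iff_prime_int.mp hp).not_isUnit
    ((h1.of_mul_right_left).isUnit_of_dvd' h2 dvd_rfl)

lemma exists_isLeftReps_atkinLehnerSet {M p : ℕ} (hp : p.Prime) (hpM : ¬ p ∣ M) :
    ∃ w, IsLeftReps (p * M) p {w} (atkinLehnerSet (p * M) p) := by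
  have hp' : (p : ℤ) ≠ 0 := by exact_mod_cast hp.ne_zero
  obtain ⟨d, b, hdb⟩ : IsCoprime (p : ℤ) M :=
    Nat.isCoprime_iff_coprime.mpr (hp.coprime_iff_not_dvd.mpr hpM)
  refine ⟨!![(p : ℤ), -b; p * M, p * d], fun x hx ↦ hx.1, fun x ↦ ?_, ?_⟩
  · simp only [Finset.mem_singleton, exists_eq_left]
    constructor
    · rintro ⟨h1, ⟨c, hc⟩, ⟨a, ha⟩, e, he⟩
      rw [Matrix.det_fin_two, hc, ha, he] at h1
      push_cast at hc h1
      have h2 : a * e * p - x 0 1 * (M * c) = 1 :=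
        mul_left_cancel₀ hp' (by linear_combination h1)
      refine ⟨⟨!![p * a * d - M * x 0 1, x 0 1 + a * b; p * M * (c * d - e), p * e + M * c * b],
        ?_⟩, mem_Gamma0_of_dvd ⟨c * d - e, ?_⟩, ?_⟩
      · rw [Matrix.det_fin_two_of]
        linear_combination h2 + (a * e * p - x 0 1 * M * c) * hdb
      · simp
      · ext i j
        fin_cases i <;> fin_cases j <;>
          simp [Matrix.mul_apply, Fin.sum_univ_two, ha, hc, he]
        · linear_combination -(p * a) * hdb
        · linear_combination -x 0 1 * hdb
        · linear_combination -(p * M * c) * hdb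
        · linear_combination -(p * e) * hdb
    · rintro ⟨γ, hγ, rfl⟩
      obtain ⟨c, hc⟩ := dvd_apply_of_mem_Gamma0 hγ
      push_cast at hc
      refine ⟨?_, ?_, ?_, ?_⟩
      · simp [Matrix.det_fin_two_of]
        linear_combination (p : ℤ) * hdb
      · simp [Matrix.mul_apply, Fin.sum_univ_two, hc]
        exact ⟨c * p, by ring⟩
      · simp [Matrix.mul_apply, Fin.sum_univ_two]
        exact ⟨γ 0 1 * M, by ring⟩
      · simp [Matrix.mul_apply, Fin.sum_univ_two, hc]
        exact ⟨-(M * c * b) + γ 1 1 * d, by ring⟩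
  · intro x hx y hy _ _ _
    rw [Finset.mem_singleton.mp hx, Finset.mem_singleton.mp hy]

/-! ### Oldforms of level `p M` coming from level `M` -/

section
variable {M p : ℕ} [NeZero M]

lemma mem_oldforms_of_coe_eq (hp : p.Prime) {h : S2 (p * M)} {g : S2 M}
    (hg : (h : ℍ → ℂ) = g) : h ∈ oldforms (p * M) := by
  refine Submodule.subset_span ⟨M, 1, ?_, ?_, g, fun τ ↦ ?_⟩
  · have := hp.one_lt
    have := NeZero.pos M
    nlinarith
  · simp
  · simp [hg, ofComplex_apply]

lemma slash_diag_apply (hp : p.Prime) (g : ℍ → ℂ) (τ : ℍ) :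
    (g ∣[(2 : ℤ)] toGLR !![(p : ℤ), 0; 0, 1]) τ = p * g (ofComplex (p * τ)) := by
  have hdet : (!![(p : ℤ), 0; 0, 1]).det = p := by simp
  have hpos : 0 < (!![(p : ℤ), 0; 0, 1]).det := by rw [hdet]; exact_mod_cast hp.pos
  have hden : denom (toGLR !![(p : ℤ), 0; 0, 1]) τ = 1 := by
    rw [denom, coe_toGLR hpos.ne']; simp
  have hsm : toGLR !![(p : ℤ), 0; 0, 1] • τ = ofComplex (p * τ) := by
    have h1 : num (toGLR !![(p : ℤ), 0; 0, 1]) τ = p * τ := by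
      rw [num, coe_toGLR hpos.ne']; simp
    rw [← h1, ← div_one (num _ _), ← hden, ← coe_smul_of_det_pos (toGLR_det_pos hpos),
      ofComplex_apply]
  rw [slash_apply, hsm, hden, toGLR_det hpos.ne', hdet, σ, if_pos (toGLR_det_pos hpos)]
  simp
  ring

lemma mem_oldforms_of_coe_eq_slash (hp : p.Prime) {h : S2 (p * M)} {g : S2 M}
    (hg : (h : ℍ → ℂ) = (g : ℍ → ℂ) ∣[(2 : ℤ)] toGLR !![(p : ℤ), 0; 0, 1]) :
    h ∈ oldforms (p * M) := by
  refine Submodule.subset_span ⟨M, p, ?_, ?_, (p : ℂ) • g, fun τ ↦ ?_⟩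
  · have := hp.one_lt
    have := NeZero.pos M
    nlinarith
  · rw [mul_comm]
  · rw [hg, slash_diag_apply hp]
    rfl

end

end

/-! ### Hecke operators and the Petersson product with a newform -/

lemma weightedInner_smul_right {N : ℕ} (f g : ℍ → ℂ) (c : ℂ) :
    weightedInner N f (c • g) = c * weightedInner N f g := by
  simp only [weightedInner]
  rw [← MeasureTheory.integral_const_mul]
  congr 1
  funext τ
  simp only [petersson, Pi.smul_apply, smul_eq_mul]
  ring

lemma weightedInner_conj_symm {N : ℕ} (f g : ℍ → ℂ) :
    weightedInner N g f = starRingEnd ℂ (weightedInner N f g) := by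
  rw [weightedInner, weightedInner, ← integral_conj]
  simp [petersson_symm 2 f g]

section
variable {N : ℕ} [NeZero N]

lemma weightedInner_add_right {f g h : ℍ → ℂ} (hf : IsBoundedForm f) (hg : IsBoundedForm g)
    (hh : IsBoundedForm h) :
    weightedInner N f (g + h) = weightedInner N f g + weightedInner N f h := by
  simp only [weightedInner]
  rw [← MeasureTheory.integral_add (hf.integrable hg) (hf.integrable hh)]
  congr 1
  funext τ
  simp only [petersson, Pi.add_apply]
  ring

/-- The Hecke operators `Tₙ` with `n` prime to the level are self-adjoint. -/
lemma peterssonInner_heckeT_of_coprime {n : ℕ} (hn : 0 < n) (h : n.Coprime N) (f g : S2 N) :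
    peterssonInner f (heckeT N n g) = starRingEnd ℂ (peterssonInner g (heckeT N n f)) := by
  have hX := isLeftReps_heckeSet N hn
  have hY : IsLeftReps N n ((reps N n).image repMat) (Matrix.adjugate ⁻¹' heckeSet N n) := by
    rwa [heckeSet_adjugate h]
  have h1 := hX.sum_weightedInner_adjugate hn hY (isBoundedForm_coe f) (isBoundedForm_coe g)
    (slash_mapGL_coe f) (slash_mapGL_coe g)
  rw [← weightedInner_sum_right (isBoundedForm_coe f) (isBoundedForm_coe g)
      fun x hx ↦ hX.det_pos hn hx, ← coe_heckeT,
    ← weightedInner_sum_right (isBoundedForm_coe g) (isBoundedForm_coe f)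
      fun x hx ↦ hX.det_pos hn hx, ← coe_heckeT] at h1
  rw [peterssonInner_eq_weightedInner, peterssonInner_eq_weightedInner, h1, map_mul]
  congr 1
  exact (Complex.conj_ofNat 2).symm

end

section
variable {M p : ℕ} [NeZero M] [NeZero (p * M)]
  {X : Finset (Matrix (Fin 2) (Fin 2) ℤ)}

/-- A newform is orthogonal to all traces, which are oldforms. -/
lemma IsNewform.weightedInner_trace {f : S2 (p * M)} (hf : IsNewform f) (hp : p.Prime)
    (hX : IsLeftReps (p * M) p X (traceSet (p * M) p)) (g : S2 (p * M)) :
    weightedInner (p * M) f (∑ x ∈ X, (g : ℍ → ℂ) ∣[(2 : ℤ)] toGLR x) = 0 := by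
  obtain ⟨t, ht⟩ := hX.exists_cuspForm (B := M) hp.pos (fun x hx γ hγ ↦ mul_mem_traceSet hx hγ) g
  obtain ⟨t', ht'⟩ := hX.exists_cuspForm (B := p * M) hp.pos (fun x hx γ hγ ↦
    mul_mem_traceSet hx (mem_Gamma0_of_dvd ((Int.natCast_dvd_natCast.mpr (dvd_mul_left M p)).trans
      (dvd_apply_of_mem_Gamma0 hγ)))) g
  have h := hf.new t' (mem_oldforms_of_coe_eq hp (ht'.trans ht.symm))
  rw [peterssonInner_eq_weightedInner, ht', mul_eq_zero] at h
  exact h.resolve_left two_ne_zero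

/-- The trace of a newform vanishes: its product with itself is a combination of products of the
newform with oldforms `u`, where `u` is a multiple of `t(p τ)` and `t` is the trace. -/
lemma IsNewform.trace_eq_zero {f : S2 (p * M)} (hf : IsNewform f) (hp : p.Prime)
    (hX : IsLeftReps (p * M) p X (traceSet (p * M) p)) :
    ∑ x ∈ X, (f : ℍ → ℂ) ∣[(2 : ℤ)] toGLR x = 0 := by
  obtain ⟨t, ht⟩ := hX.exists_cuspForm (B := M) hp.pos (fun x hx γ hγ ↦ mul_mem_traceSet hx hγ) f
  obtain ⟨t', ht'⟩ := hX.exists_cuspForm (B := p * M) hp.pos (fun x hx γ hγ ↦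
    mul_mem_traceSet hx (mem_Gamma0_of_dvd ((Int.natCast_dvd_natCast.mpr (dvd_mul_left M p)).trans
      (dvd_apply_of_mem_Gamma0 hγ)))) f
  have htt : (t' : ℍ → ℂ) = t := ht'.trans ht.symm
  obtain ⟨Y, hY⟩ := exists_isLeftReps_adjugate_traceSet (M := M) hp.pos
  have hM := isLeftReps_adjugate_traceSet (M := M) hp.pos
  obtain ⟨u, hu⟩ := hM.exists_cuspForm (B := p * M) hp.pos
    (fun x hx γ hγ ↦ mul_mem_adjugate_traceSet hx hγ) t
  rw [Finset.sum_singleton] at hu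
  have h0 : weightedInner (p * M) f u = 0 := by
    have h := hf.new u (mem_oldforms_of_coe_eq_slash hp hu)
    rw [peterssonInner_eq_weightedInner, mul_eq_zero] at h
    exact h.resolve_left two_ne_zero
  have h1 : ∀ y ∈ Y, (t' : ℍ → ℂ) ∣[(2 : ℤ)] toGLR y = u := by
    intro y hy
    obtain ⟨δ, hδ, x, hx, rfl⟩ := (hM.mem_iff y).mp (hY.subset hy)
    rw [Finset.mem_singleton.mp hx] at *
    rw [htt, slash_toGLR_mul_of_mem (slash_mapGL_coe t) hδ (by simp [hp.ne_zero]), hu]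
  have h2 := hX.sum_weightedInner_adjugate hp.pos hY (isBoundedForm_coe t') (isBoundedForm_coe f)
    (slash_mapGL_coe t') (slash_mapGL_coe f)
  have h4 : ∑ y ∈ Y, weightedInner (p * M) f ((t' : ℍ → ℂ) ∣[(2 : ℤ)] toGLR y) = 0 :=
    Finset.sum_eq_zero fun y hy ↦ by rw [h1 y hy, h0]
  rw [h4, map_zero, ← weightedInner_sum_right (isBoundedForm_coe t') (isBoundedForm_coe f)
      fun x hx ↦ hX.det_pos hp.pos hx, ← ht'] at h2
  have h3 : t' = 0 := eq_zero_of_peterssonInner_self (by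
    rw [peterssonInner_eq_weightedInner, h2, mul_zero])
  rw [← ht', h3]
  rfl

end

/-- For a newform `f`, the functional `g ↦ ⟨f, g⟩` is an eigenvector of all Hecke operators of
prime index, including those that divide the level. -/
lemma IsNewform.exists_peterssonInner_heckeT_prime {N : ℕ} [NeZero N] {f : S2 N}
    (hf : IsNewform f) {p : ℕ} (hp : p.Prime) :
    ∃ c : ℂ, ∀ g, peterssonInner f (heckeT N p g) = c * peterssonInner f g := by
  obtain ⟨c, hc⟩ := hf.eigen p hp.pos
  by_cases hpN : p ∣ N
  · obtain ⟨M, rfl⟩ := hpN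
    have : NeZero M := ⟨fun h ↦ NeZero.ne (p * M) (by rw [h, mul_zero])⟩
    have hH := isLeftReps_heckeSet (p * M) hp.pos
    by_cases hpM : p ∣ M
    · -- If `p² ∣ N`, then `T_p g` is itself a trace, so an oldform.
      refine ⟨0, fun g ↦ ?_⟩
      rw [← traceSet_eq_heckeSet hp hpM] at hH
      rw [peterssonInner_eq_weightedInner, coe_heckeT, hf.weightedInner_trace hp hH, mul_zero,
        zero_mul]
    · -- If `p ∥ N`, traces are `T_p g + g | w` with `w` an Atkin-Lehner matrix, and `g ↦ g | w` is
      -- self-adjoint. The trace of `f` vanishes, so `f | w = -c f`.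
      refine ⟨starRingEnd ℂ c, fun g ↦ ?_⟩
      obtain ⟨w, hw⟩ := exists_isLeftReps_atkinLehnerSet hp hpM
      have hdis := disjoint_heckeSet_atkinLehnerSet (M := M) hp
      have hX := isLeftReps_union hH hw hdis
      rw [← traceSet_eq_union hp] at hX
      have hXdis : Disjoint ((reps (p * M) p).image repMat) {w} := by
        rw [Finset.disjoint_singleton_right]
        exact fun h ↦ Set.disjoint_left.mp hdis (hH.subset h)
          (hw.subset (Finset.mem_singleton_self w))
      have hsum : ∀ g : S2 (p * M), ∑ x ∈ (reps (p * M) p).image repMat ∪ {w},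
          (g : ℍ → ℂ) ∣[(2 : ℤ)] toGLR x = heckeT (p * M) p g + (g : ℍ → ℂ) ∣[(2 : ℤ)] toGLR w := by
        intro g
        rw [Finset.sum_union hXdis, Finset.sum_singleton, coe_heckeT]
      have hfw : (f : ℍ → ℂ) ∣[(2 : ℤ)] toGLR w = (-c) • (f : ℍ → ℂ) := by
        have h := hf.trace_eq_zero hp hX
        rw [hsum, hc, add_eq_zero_iff_neg_eq] at h
        rw [← h]
        exact (neg_smul c (f : ℍ → ℂ)).symm
      have hdetw := hw.det_pos hp.pos (Finset.mem_singleton_self w)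
      have h1 := hf.weightedInner_trace hp hX g
      rw [hsum, weightedInner_add_right (isBoundedForm_coe f) (isBoundedForm_coe _)
        ((isBoundedForm_coe g).slash (toGLR_det_pos hdetw))] at h1
      have h2 := hw.sum_weightedInner_adjugate hp.pos (by rwa [atkinLehnerSet_adjugate])
        (isBoundedForm_coe f) (isBoundedForm_coe g) (slash_mapGL_coe f) (slash_mapGL_coe g)
      rw [Finset.sum_singleton, Finset.sum_singleton, hfw, weightedInner_smul_right, map_mul,
        ← weightedInner_conj_symm, map_neg] at h2
      rw [h2] at h1
      rw [peterssonInner_eq_weightedInner, peterssonInner_eq_weightedInner]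
      linear_combination 2 * h1
  · refine ⟨starRingEnd ℂ c, fun g ↦ ?_⟩
    rw [peterssonInner_heckeT_of_coprime hp.pos (hp.coprime_iff_not_dvd.mpr hpN), hc,
      peterssonInner_smul, map_mul, ← peterssonInner_conj_symm]

/-- The case of a general index follows from that of primes by the relation
`T_p T_n = T_{pn} + p T_{n/p}`. -/
lemma IsNewform.exists_peterssonInner_heckeT {N : ℕ} [NeZero N] {f : S2 N}
    (hf : IsNewform f) (n : ℕ) :
    ∃ c : ℂ, ∀ g, peterssonInner f (heckeT N n g) = c * peterssonInner f g := by
  induction n using Nat.strong_induction_on with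
  | h n ih =>
    rcases Nat.eq_zero_or_pos n with rfl | hn
    · exact ⟨0, fun g ↦ by
        rw [heckeT_zero, zero_mul]
        exact (peterssonLinear f).map_zero⟩
    rcases eq_or_ne n 1 with rfl | hn1
    · exact ⟨1, fun g ↦ by rw [heckeT_one, Module.End.one_apply, one_mul]⟩
    obtain ⟨p, hp, m, rfl⟩ := Nat.exists_prime_and_dvd hn1
    have hm : 0 < m := Nat.pos_of_mul_pos_left hn
    have hlt : m < p * m := by nlinarith [hp.one_lt]
    obtain ⟨c, hc⟩ := hf.exists_peterssonInner_heckeT_prime hp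
    obtain ⟨d, hd⟩ := ih m hlt
    obtain ⟨e, he⟩ := ih (m / p) ((Nat.div_le_self m p).trans_lt hlt)
    have key : ∀ g, peterssonInner f (heckeT N (p * m) g) = c * (d * peterssonInner f g) -
        if ¬ p ∣ N ∧ p ∣ m then p * (e * peterssonInner f g) else 0 := by
      intro g
      have h := congrArg (peterssonLinear f) (heckeT_mul_prime hp hm g)
      rw [map_add, apply_ite (peterssonLinear f), map_smul, map_zero] at h
      change peterssonInner f _ = peterssonInner f _ + ite _ (_ • peterssonInner f _) _ at h
      rw [hc, hd, he, smul_eq_mul] at h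
      rw [h, add_sub_cancel_right]
    split_ifs at key with h
    · exact ⟨c * d - p * e, fun g ↦ by rw [key]; ring⟩
    · exact ⟨c * d, fun g ↦ by rw [key]; ring⟩

/-! ### Rationality and the congruence module -/

section
variable {N : ℕ} [NeZero N] {f : S2 N}

lemma IsNewform.heckeT_self (hf : IsNewform f) (n : ℕ) :
    heckeT N n f = fourierCoeff f n • f := by
  rcases Nat.eq_zero_or_pos n with rfl | hn
  · rw [heckeT_zero, fourierCoeff_zero_right, zero_smul]
  · obtain ⟨c, hc⟩ := hf.eigen n hn
    have h := fourierCoeff_one_heckeT n f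
    rw [hc, fourierCoeff_smul, hf.normalized, mul_one] at h
    rw [hc, h]

lemma IsNewform.peterssonInner_self_ne_zero (hf : IsNewform f) : peterssonInner f f ≠ 0 := by
  intro h
  have h1 := hf.normalized
  rw [eq_zero_of_peterssonInner_self h, fourierCoeff_zero_left] at h1
  exact zero_ne_one h1

/-- The functional `g ↦ ⟨f, g⟩` has the same Hecke eigenvalues as `f`. -/
lemma IsNewform.peterssonInner_heckeT (hf : IsNewform f) (n : ℕ) (g : S2 N) :
    peterssonInner f (heckeT N n g) = fourierCoeff f n * peterssonInner f g := by
  obtain ⟨c, hc⟩ := hf.exists_peterssonInner_heckeT n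
  have h := hc f
  rw [hf.heckeT_self, peterssonInner_smul] at h
  rw [hc, mul_right_cancel₀ hf.peterssonInner_self_ne_zero h]

end

/-- Fourier coefficients span the dual of `S₂(Γ₀(N))`. -/
lemma exists_eq_sum_fourierCoeff {N : ℕ} [NeZero N] (l : S2 N →ₗ[ℂ] ℂ) :
    ∃ (B : ℕ) (d : Fin B → ℂ), ∀ g : S2 N, l g = ∑ i, d i * fourierCoeff g i := by
  obtain ⟨B, hB⟩ := exists_sturm_bound N
  let e : S2 N →ₗ[ℂ] (Fin B → ℂ) := LinearMap.pi fun i ↦ fourierCoeffLinear N i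
  have he : LinearMap.ker e = ⊥ := LinearMap.ker_eq_bot'.mpr fun g hg ↦
    hB g fun n hn ↦ congrFun hg ⟨n, hn⟩
  obtain ⟨r, hr⟩ := e.exists_leftInverse_of_injective he
  refine ⟨B, fun i ↦ l (r fun j ↦ if i = j then 1 else 0), fun g ↦ ?_⟩
  have h := (l ∘ₗ r).pi_apply_eq_sum_univ (e g)
  have hrg : r (e g) = g := LinearMap.congr_fun hr g
  rw [LinearMap.comp_apply, hrg] at h
  refine h.trans (Finset.sum_congr rfl fun i _ ↦ ?_)
  rw [smul_eq_mul, mul_comm]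
  rfl

lemma heckeT_mem_integralCuspForms {N : ℕ} [NeZero N] {g : S2 N} (hg : g ∈ integralCuspForms N)
    (n : ℕ) : heckeT N n g ∈ integralCuspForms N := by
  choose c hc using hg
  intro m
  refine ⟨∑ x ∈ n.divisorsAntidiagonal with x.1.Coprime N,
    if x.1 ∣ m then x.1 * c (x.2 * (m / x.1)) else 0, ?_⟩
  rw [fourierCoeff_heckeT]
  push_cast
  refine Finset.sum_congr rfl fun x _ ↦ ?_
  rw [hc]

/-- If `f` has integral coefficients, the numbers `⟨f, g⟩` for `g` with integral coefficients are
rational multiples of `⟨f, f⟩`, with bounded denominators. By the symmetry of `(n, m) ↦ aₘ(Tₙ g)`,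
a functional on forms with integral coefficients is determined up to scalars by its Hecke
eigenvalues; this applies to the composite of `g ↦ ⟨f, g⟩` with any `ℚ`-linear map `ℂ → ℚ`. -/
lemma IsNewform.exists_rational_functional {N : ℕ} [NeZero N] {f : S2 N} (hf : IsNewform f)
    (hfint : f ∈ integralCuspForms N) :
    ∃ D : ℕ, 0 < D ∧ ∀ g ∈ integralCuspForms N, ∃ k : ℤ,
      D * peterssonInner f g = k * peterssonInner f f := by
  obtain ⟨B, d, hd⟩ := exists_eq_sum_fourierCoeff (peterssonLinear f)
  replace hd : ∀ g, peterssonInner f g = ∑ i, d i * fourierCoeff g i := hd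
  obtain ⟨l, hl⟩ : ∃ l : ℂ →ₗ[ℚ] ℚ, l (peterssonInner f f) = 1 :=
    Module.Projective.exists_dual_eq_one ℚ hf.peterssonInner_self_ne_zero
  have hlint : ∀ (k : ℤ) (z : ℂ), l (z * k) = l z * k := fun k z ↦ by
    rw [mul_comm, ← zsmul_eq_mul, map_zsmul, zsmul_eq_mul, mul_comm]
  have hlg : ∀ g ∈ integralCuspForms N,
      (l (peterssonInner f g) : ℂ) = ∑ i, (l (d i) : ℂ) * fourierCoeff g i := by
    intro g hg
    rw [hd, map_sum, Rat.cast_sum]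
    refine Finset.sum_congr rfl fun i _ ↦ ?_
    obtain ⟨k, hk⟩ := hg i
    rw [hk, hlint]
    push_cast
    rfl
  have key : ∀ g ∈ integralCuspForms N,
      peterssonInner f g = l (peterssonInner f g) * peterssonInner f f := by
    intro g hg
    have h1 : ∑ i, (l (d i) : ℂ) * peterssonInner f (heckeT N i g) = peterssonInner f g := by
      simp_rw [hf.peterssonInner_heckeT, ← mul_assoc]
      rw [← Finset.sum_mul, ← hlg f hfint, hl, Rat.cast_one, one_mul]
    have h2 : ∑ j, d j * (l (peterssonInner f (heckeT N j g)) : ℂ) =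
        l (peterssonInner f g) * peterssonInner f f := by
      rw [hd f, Finset.mul_sum]
      refine Finset.sum_congr rfl fun j _ ↦ ?_
      obtain ⟨k, hk⟩ := hfint j
      rw [hf.peterssonInner_heckeT, hk, mul_comm (k : ℂ) (peterssonInner f g), hlint]
      push_cast
      ring
    calc peterssonInner f g
        = ∑ i, ∑ j, (l (d i) : ℂ) * (d j * fourierCoeff (heckeT N i g) j) := by
          rw [← h1]
          exact Finset.sum_congr rfl fun i _ ↦ by rw [hd (heckeT N i g), Finset.mul_sum]
      _ = ∑ j, ∑ i, d j * ((l (d i) : ℂ) * fourierCoeff (heckeT N j g) i) := by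
          rw [Finset.sum_comm]
          refine Finset.sum_congr rfl fun j _ ↦ Finset.sum_congr rfl fun i _ ↦ ?_
          rw [fourierCoeff_heckeT_comm]
          ring
      _ = l (peterssonInner f g) * peterssonInner f f := by
          rw [← h2]
          exact Finset.sum_congr rfl fun j _ ↦ by
            rw [hlg _ (heckeT_mem_integralCuspForms hg j), Finset.mul_sum]
  refine ⟨∏ i, (l (d i)).den, Finset.prod_pos fun i _ ↦ (l (d i)).den_pos, fun g hg ↦ ?_⟩
  choose c hc using hg
  refine ⟨∑ i, (∏ j ∈ Finset.univ.erase i, ((l (d j)).den : ℤ)) * (l (d i)).num * c i, ?_⟩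
  rw [key g fun n ↦ ⟨c n, hc n⟩, hlg g fun n ↦ ⟨c n, hc n⟩, ← mul_assoc, Finset.mul_sum]
  push_cast
  congr 1
  refine Finset.sum_congr rfl fun i _ ↦ ?_
  rw [← Finset.mul_prod_erase _ _ (Finset.mem_univ i), hc]
  have h : ((l (d i)).den : ℂ) * l (d i) = (l (d i)).num := by
    exact_mod_cast Rat.den_mul_eq_num (l (d i))
  linear_combination (∏ j ∈ Finset.univ.erase i, ((l (d j)).den : ℂ)) * c i * h

/-- For a newform `f` with integral coefficients, the map `g ↦ m ⟨f, g⟩ / ⟨f, f⟩` is, for a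
suitable `m ≥ 1`, a surjection from `S₂(Γ₀(N), ℤ)` onto `ℤ`. -/
lemma IsNewform.exists_integral_functional {N : ℕ} [NeZero N] {f : S2 N} (hf : IsNewform f)
    (hfint : f ∈ integralCuspForms N) :
    ∃ (m : ℕ) (ψ : integralCuspForms N →ₗ[ℤ] ℤ), 0 < m ∧ Function.Surjective ψ ∧
      ψ ⟨f, hfint⟩ = m ∧
      ∀ g : integralCuspForms N, (m : ℂ) * peterssonInner f g = ψ g * peterssonInner f f := by
  have hne := hf.peterssonInner_self_ne_zero
  obtain ⟨D, hD, h⟩ := hf.exists_rational_functional hfint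
  -- The values of `D ⟨f, g⟩ / ⟨f, f⟩` form an ideal of `ℤ`, generated by some `d`; the right
  -- integer is `m = D / d`.
  let A : Ideal ℤ :=
    { carrier := {k | ∃ g ∈ integralCuspForms N, D * peterssonInner f g = k * peterssonInner f f}
      add_mem' := by
        rintro a b ⟨g, hg, ha⟩ ⟨g', hg', hb⟩
        refine ⟨g + g', add_mem hg hg', ?_⟩
        rw [peterssonInner_add]
        push_cast
        linear_combination ha + hb
      zero_mem' := ⟨0, zero_mem _, by
        rw [show peterssonInner f 0 = 0 from (peterssonLinear f).map_zero]
        simp⟩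
      smul_mem' := by
        rintro c a ⟨g, hg, ha⟩
        refine ⟨c • g, Submodule.smul_mem _ c hg, ?_⟩
        rw [show peterssonInner f (c • g) = c • peterssonInner f g from
          map_zsmul (peterssonLinear f) c g, zsmul_eq_mul, smul_eq_mul]
        push_cast
        linear_combination c * ha }
  obtain ⟨d, hd⟩ : ∃ d : ℕ, A = Ideal.span {(d : ℤ)} := by
    obtain ⟨d, hd⟩ := (IsPrincipalIdealRing.principal A).principal
    exact ⟨d.natAbs,
      hd.trans (Ideal.span_singleton_eq_span_singleton.mpr (Int.associated_natAbs d))⟩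
  have hDA : (D : ℤ) ∈ A := ⟨f, hfint, by push_cast; rfl⟩
  rw [hd, Ideal.mem_span_singleton, Int.natCast_dvd_natCast] at hDA
  obtain ⟨m, rfl⟩ := hDA
  have hdpos : 0 < d := Nat.pos_of_mul_pos_right hD
  have hd0 : (d : ℂ) ≠ 0 := by exact_mod_cast hdpos.ne'
  have key : ∀ g : integralCuspForms N, ∃ k : ℤ,
      (m : ℂ) * peterssonInner f g = k * peterssonInner f f := by
    intro g
    obtain ⟨k, hk⟩ := h g g.2
    have hkA : k ∈ A := ⟨g, g.2, hk⟩
    rw [hd, Ideal.mem_span_singleton] at hkA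
    obtain ⟨k, rfl⟩ := hkA
    refine ⟨k, mul_left_cancel₀ hd0 ?_⟩
    push_cast at hk
    linear_combination hk
  choose ψ hψ using key
  have huniq : ∀ {a b : ℤ}, (a : ℂ) * peterssonInner f f = b * peterssonInner f f → a = b :=
    fun h ↦ by exact_mod_cast mul_right_cancel₀ hne h
  refine ⟨m, ⟨⟨ψ, fun g g' ↦ huniq ?_⟩, fun c g ↦ huniq ?_⟩, Nat.pos_of_mul_pos_left hD, ?_, ?_, hψ⟩
  · rw [← hψ, Submodule.coe_add, peterssonInner_add]
    push_cast
    linear_combination hψ g + hψ g'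
  · change (ψ (c • g) : ℂ) * _ = _
    rw [← hψ, show peterssonInner f (c • g : integralCuspForms N) = c • peterssonInner f g from
      map_zsmul (peterssonLinear f) c g.1, zsmul_eq_mul]
    simp only [RingHom.id_apply, smul_eq_mul]
    push_cast
    linear_combination c * hψ g
  · intro k
    have hk : (d : ℤ) * k ∈ A := by
      rw [hd]
      exact Ideal.mul_mem_right _ _ (Ideal.mem_span_singleton_self _)
    obtain ⟨g, hg, hgk⟩ := hk
    refine ⟨⟨g, hg⟩, huniq (mul_left_cancel₀ hd0 ?_)⟩
    have h1 := hψ ⟨g, hg⟩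
    push_cast at hgk
    change (d : ℂ) * (ψ ⟨g, hg⟩ * _) = _
    linear_combination hgk - d * h1
  · refine huniq ?_
    change (ψ ⟨f, hfint⟩ : ℂ) * _ = _
    rw [← hψ]
    push_cast
    rfl

/-- By multiplicity one for the full Hecke algebra, the `I_f`-torsion is generated by `f`. -/
lemma IsNewform.integralTorsion_heckeAnnihilator {N : ℕ} [NeZero N] {f : S2 N} (hf : IsNewform f)
    (hfint : f ∈ integralCuspForms N) :
    integralTorsion (heckeAnnihilator f) = Submodule.span ℤ {⟨f, hfint⟩} := by
  apply le_antisymm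
  · intro g hg
    obtain ⟨c, hc⟩ := g.2 1
    refine Submodule.mem_span_singleton.mpr ⟨c, Subtype.ext (fourierCoeff_ext fun n ↦ ?_)⟩
    rcases Nat.eq_zero_or_pos n with rfl | hn
    · rw [fourierCoeff_zero_right, fourierCoeff_zero_right]
    obtain ⟨k, hk⟩ := hfint n
    have hT : heckeT N n ∈ heckeAlgebra N := Algebra.subset_adjoin ⟨n, hn, rfl⟩
    have hmem : (⟨heckeT N n, hT⟩ - algebraMap ℤ (heckeAlgebra N) k : heckeAlgebra N) ∈
        heckeAnnihilator f := by
      change (heckeT N n - algebraMap ℤ (Module.End ℂ (S2 N)) k) f = 0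
      rw [LinearMap.sub_apply, hf.heckeT_self, hk, Module.algebraMap_end_apply, sub_eq_zero,
        Int.cast_smul_eq_zsmul]
    have h := hg _ hmem
    change (heckeT N n - algebraMap ℤ (Module.End ℂ (S2 N)) k) g.1 = 0 at h
    rw [LinearMap.sub_apply, Module.algebraMap_end_apply, sub_eq_zero] at h
    have h1 := fourierCoeff_one_heckeT n g.1
    rw [h, ← Int.cast_smul_eq_zsmul ℂ, fourierCoeff_smul, hc] at h1
    change fourierCoeff (c • f) n = _
    rw [← h1, ← Int.cast_smul_eq_zsmul ℂ, fourierCoeff_smul, hk, mul_comm]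
  · rw [Submodule.span_singleton_le_iff_mem]
    exact fun T hT ↦ hT

lemma finite_quotient_span_sup_ker {A : Type*} [AddCommGroup A] {ψ : A →ₗ[ℤ] ℤ}
    (hψ : Function.Surjective ψ) {m : ℕ} (hm : 0 < m) {x : A} (hx : ψ x = m) :
    Finite (A ⧸ (Submodule.span ℤ {x} ⊔ LinearMap.ker ψ)) ∧
      Nat.card (A ⧸ (Submodule.span ℤ {x} ⊔ LinearMap.ker ψ)) = m := by
  let θ : A →ₗ[ℤ] ZMod m := (Int.castAddHom (ZMod m)).toIntLinearMap ∘ₗ ψ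
  have hθ : Function.Surjective θ := (ZMod.intCast_surjective (n := m)).comp hψ
  have hsup : Submodule.span ℤ {x} ⊔ LinearMap.ker ψ = LinearMap.ker θ := by
    apply le_antisymm
    · rw [sup_le_iff, Submodule.span_singleton_le_iff_mem]
      constructor
      · change ((ψ x : ℤ) : ZMod m) = 0
        rw [hx, Int.cast_natCast, ZMod.natCast_self]
      · intro g hg
        change ((ψ g : ℤ) : ZMod m) = 0
        rw [LinearMap.mem_ker.mp hg, Int.cast_zero]
    · intro g hg
      obtain ⟨k, hk⟩ := (ZMod.intCast_zmod_eq_zero_iff_dvd (ψ g) m).mp hg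
      refine Submodule.mem_sup.mpr ⟨k • x, Submodule.smul_mem _ k
        (Submodule.mem_span_singleton_self _), g - k • x, ?_, add_sub_cancel _ _⟩
      rw [LinearMap.mem_ker, map_sub, map_smul, hx, hk, smul_eq_mul, mul_comm, sub_self]
  have hequiv : (A ⧸ (Submodule.span ℤ {x} ⊔ LinearMap.ker ψ)) ≃ ZMod m :=
    ((Submodule.quotEquivOfEq _ _ hsup).trans (θ.quotKerEquivOfSurjective hθ)).toEquiv
  have : NeZero m := ⟨hm.ne'⟩
  exact ⟨Finite.of_equiv _ hequiv.symm, by rw [Nat.card_congr hequiv, Nat.card_zmod]⟩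

/-- The congruence number and the congruence module in terms of the surjection `ψ` onto `ℤ`
proportional to `g ↦ ⟨f, g⟩`. -/
theorem IsNewform.isGreatest_congruenceModuli {N : ℕ} [NeZero N] {f : S2 N} (hf : IsNewform f)
    (hfint : f ∈ integralCuspForms N) :
    ∃ m : ℕ, IsGreatest (congruenceModuli f) m ∧
      Disjoint (integralTorsion (heckeAnnihilator f))
        (integralOrthogonal (integralTorsion (heckeAnnihilator f))) ∧
      Finite (congruenceModule f) ∧ Nat.card (congruenceModule f) = m := by
  obtain ⟨m, ψ, hm, hsurj, hψf, hψ⟩ := hf.exists_integral_functional hfint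
  have hne := hf.peterssonInner_self_ne_zero
  have hm0 : (m : ℂ) ≠ 0 := by exact_mod_cast hm.ne'
  have hker : ∀ g : integralCuspForms N, ψ g = 0 ↔ peterssonInner f g = 0 := by
    intro g
    have h := hψ g
    constructor
    · intro h0
      rw [h0, Int.cast_zero, zero_mul] at h
      exact (mul_eq_zero.mp h).resolve_left hm0
    · intro h0
      rw [h0, mul_zero] at h
      exact_mod_cast (mul_eq_zero.mp h.symm).resolve_right hne
  have htors := hf.integralTorsion_heckeAnnihilator hfint
  have horth : integralOrthogonal (integralTorsion (heckeAnnihilator f)) = LinearMap.ker ψ := by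
    ext g
    rw [LinearMap.mem_ker, hker]
    constructor
    · exact fun h ↦ h ⟨f, hfint⟩ (htors ▸ Submodule.mem_span_singleton_self _)
    · intro h x hx
      rw [htors] at hx
      obtain ⟨c, rfl⟩ := Submodule.mem_span_singleton.mp hx
      have h1 : peterssonInner (g : S2 N) ((c • ⟨f, hfint⟩ : integralCuspForms N) : S2 N) =
          c • peterssonInner g.1 f := map_zsmul (peterssonLinear g.1) c f
      rw [peterssonInner_conj_symm, h1, peterssonInner_conj_symm, h]
      simp
  have hcard := finite_quotient_span_sup_ker hsurj hm hψf
  rw [← horth, ← htors] at hcard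
  refine ⟨m, ⟨?_, ?_⟩, ?_, hcard⟩
  · -- Subtracting from `f` the `m`-fold of a preimage of `1` gives a form orthogonal to `f`.
    obtain ⟨h, hh⟩ := hsurj 1
    let g : integralCuspForms N := ⟨f, hfint⟩ - (m : ℤ) • h
    have hg : ψ g = 0 := by
      rw [map_sub, map_smul, hψf, hh, smul_eq_mul, mul_one, sub_self]
    refine ⟨g, g.2, (hker g).mp hg, fun n ↦ ?_⟩
    obtain ⟨c, hc⟩ := h.2 n
    refine ⟨c, ?_⟩
    have h1 : fourierCoeff g.1 n = fourierCoeff f n - (m : ℤ) • fourierCoeff h.1 n := by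
      have h2 := map_sub (fourierCoeffLinear N n) f ((m : ℤ) • h.1)
      rw [map_zsmul] at h2
      exact h2
    rw [h1, hc, zsmul_eq_mul, sub_sub_cancel, Int.cast_natCast]
  · rintro r ⟨g, hg, hfg, hr⟩
    choose c hc using hr
    rcases Nat.eq_zero_or_pos r with rfl | hr0
    · exact hm.le
    have hr1 : (r : ℂ) ≠ 0 := by exact_mod_cast hr0.ne'
    have hh : ∀ n, fourierCoeff ((r : ℂ)⁻¹ • (f - g)) n = c n := by
      intro n
      have h1 : fourierCoeff (f - g) n = fourierCoeff f n - fourierCoeff g n :=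
        map_sub (fourierCoeffLinear N n) f g
      rw [fourierCoeff_smul, h1, hc, inv_mul_cancel_left₀ hr1]
    let h : integralCuspForms N := ⟨(r : ℂ)⁻¹ • (f - g), fun n ↦ ⟨c n, hh n⟩⟩
    have h1 : (⟨f, hfint⟩ - ⟨g, hg⟩ : integralCuspForms N) = (r : ℤ) • h := by
      apply Subtype.ext
      change f - g = (r : ℤ) • ((r : ℂ)⁻¹ • (f - g))
      rw [← Int.cast_smul_eq_zsmul ℂ, smul_smul, Int.cast_natCast, mul_inv_cancel₀ hr1, one_smul]
    have h2 := congrArg ψ h1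
    rw [map_sub, hψf, (hker ⟨g, hg⟩).mpr hfg, sub_zero, map_smul, smul_eq_mul] at h2
    exact Nat.le_of_dvd hm (Int.natCast_dvd_natCast.mp ⟨_, h2⟩)
  · rw [horth, htors, Submodule.disjoint_def]
    intro x hx hx'
    obtain ⟨c, rfl⟩ := Submodule.mem_span_singleton.mp hx
    rw [LinearMap.mem_ker, map_smul, hψf, smul_eq_mul, mul_eq_zero] at hx'
    rw [hx'.resolve_right (by exact_mod_cast hm.ne'), zero_smul]

end CongruenceNumber

theorem mainTheorem11 (E : WeierstrassCurve ℚ) [E.IsElliptic] (N : ℕ) [NeZero N]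
    (f : CongruenceNumber.S2 N) (hf : CongruenceNumber.IsNewformOf E f) :
    IsGreatest (CongruenceNumber.congruenceModuli f) (CongruenceNumber.congruenceNumber f) ∧
    Disjoint (CongruenceNumber.integralTorsion (CongruenceNumber.heckeAnnihilator f))
      (CongruenceNumber.integralOrthogonal
        (CongruenceNumber.integralTorsion (CongruenceNumber.heckeAnnihilator f))) ∧
    Finite (CongruenceNumber.congruenceModule f) ∧
    CongruenceNumber.congruenceNumber f = Nat.card (CongruenceNumber.congruenceModule f) := by
  obtain ⟨m, hgreatest, hdisj, hfin, hcard⟩ :=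
    hf.toIsNewform.isGreatest_congruenceModuli fun n ↦ ⟨_, hf.coeff_eq n⟩
  have hm : CongruenceNumber.congruenceNumber f = m := hgreatest.csSup_eq
  exact ⟨hm ▸ hgreatest, hdisj, hfin, hm.trans hcard.symm⟩
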